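/- **Theorem 2.3 (Uniqueness Theorem).** Let $L^2(0,1)$ be the space of real square-integrable functions on $(0,1)$. For $(q;b)\in L^2(0,1)\times\mathbb R$ let $H$ be the self-adjoint operator $H\psi=-\psi''+q\psi$ in $L^2(0,1)$ with the boundary conditions $\psi(0)=0$, $\psi'(1)+b\psi(1)=0$, and let $\lambda_0(q,b)<\lambda_1(q,b)<\dots$ be its eigenvalues, all of which are simple. For $\lambda\in\mathbb R$ let $\varphi(\cdot,\lambda,q)$ be the solution of $-\varphi''+q\varphi=\lambda\varphi$ on $[0,1]$ with $\varphi(0)=0$, $\varphi'(0)=1$, and define the norming constants by $$\nu_n(q,b)=\log\left[(-1)^n\varphi(1,\lambda_n(q,b),q)\right],\qquad n\ge 0 .$$ If $(q;b),(p;h)\in L^2(0,1)\times\mathbb R$ satisfy $\lambda_n(q,b)=\lambda_n(p,h)$ and $\nu_n(q,b)=\nu_n(p,h)$ for all $n\ge 0$, then $(q;b)=(p;h)$, that is, $q=p$ almost everywhere on $(0,1)$ and $b=h$. -/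

import Mathlib

open MeasureTheory Set

noncomputable section

namespace MixedSturmLiouville

/-- Lebesgue measure on `(0,1)`. -/
abbrev unitMeasure : Measure ℝ := volume.restrict (Ioo (0 : ℝ) 1)

/-- The real Hilbert space `L²(0,1)`. -/
abbrev L2 : Type := Lp ℝ 2 unitMeasure

/-- The derivative `y'` of a function on `[0,1]`, one-sided at the endpoints. -/
def D (y : ℝ → ℝ) : ℝ → ℝ := derivWithin y (Icc 0 1)

/-- `y` is differentiable on `[0,1]` and `y'` is absolutely continuous there, so that `y''` exists
almost everywhere, is integrable, and `y'` is a primitive of it. -/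
structure IsRegular (y : ℝ → ℝ) : Prop where
  differentiableOn : DifferentiableOn ℝ y (Icc 0 1)
  absolutelyContinuous : AbsolutelyContinuousOnInterval (D y) 0 1

/-- The differential expression `-y'' + q y`. -/
def expression (q y : ℝ → ℝ) : ℝ → ℝ := fun x => -deriv (D y) x + q x * y x

/-- The domain of the operator `H = -d²/dx² + q` in `L²(0,1)` with the boundary conditions
`y(0) = 0`, `y'(1) + b y(1) = 0`. -/
structure InDomain (q : ℝ → ℝ) (b : ℝ) (y : ℝ → ℝ) : Prop where
  regular : IsRegular y
  memLp : MemLp (expression q y) 2 unitMeasure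
  left_bc : y 0 = 0
  right_bc : D y 1 + b * y 1 = 0

/-- `r` is an eigenvalue of the self-adjoint operator `H`: some `y ≠ 0` in the domain of `H`
satisfies `H y = r y` in `L²(0,1)`. -/
def IsEigenvalue (q : ℝ → ℝ) (b r : ℝ) : Prop :=
  ∃ y : ℝ → ℝ, InDomain q b y ∧ ¬ y =ᵐ[unitMeasure] 0 ∧
    expression q y =ᵐ[unitMeasure] fun x => r * y x

/-- `λₙ(q,b)`, `n ≥ 0`: the eigenvalues of `H` in increasing order (all of them are simple).
The value at `n` is the least `t` such that at least `n + 1` eigenvalues are `≤ t`. -/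
def eigenvalue (q : ℝ → ℝ) (b : ℝ) (n : ℕ) : ℝ :=
  sInf {t : ℝ | (n + 1 : ℕ∞) ≤ {r : ℝ | IsEigenvalue q b r ∧ r ≤ t}.encard}

/-- `y` solves `-y'' + q y = r y` on `[0,1]` with `y(0) = 0`, `y'(0) = 1`. -/
structure IsPhi (q : ℝ → ℝ) (r : ℝ) (y : ℝ → ℝ) : Prop where
  regular : IsRegular y
  equation : expression q y =ᵐ[unitMeasure] fun x => r * y x
  value_zero : y 0 = 0
  deriv_zero : D y 0 = 1

/-- `φ(·,r,q)`: the solution of the initial value problem `IsPhi`. It is unique on `[0,1]`; outside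
this interval the values have no meaning. -/
def phi (q : ℝ → ℝ) (r : ℝ) : ℝ → ℝ := Classical.epsilon (IsPhi q r)

/-- The norming constants `νₙ(q,b) = log[(-1)ⁿ φ(1, λₙ(q,b), q)]`. -/
def normingConstant (q : ℝ → ℝ) (b : ℝ) (n : ℕ) : ℝ :=
  Real.log ((-1) ^ n * phi q (eigenvalue q b n) 1)

end MixedSturmLiouville

end

/-!
Let `ψ` be the solution with `ψ(1) = 1`, `ψ'(1) = -b`. The eigenvalues are the zeros of the entire
function `w = φ'ψ - φψ' = φ'(1) + b φ(1)`, and they are real. At such a zero `φ = φ(1) ψ` and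
`φ(1) w' = -∫ φ² < 0`, so the zeros are simple and the sign of `φ(1)` is determined by `w'`.

For two problems with the same eigenvalues, `w_p / w_q` extends to a function without real zeros
which is positive near `-∞`; hence `w_q'` and `w_p'` have the same sign at each eigenvalue. Equal
norming constants give equal `|φ(1)|`, hence equal `φ(1)`, so `G = φ_q ψ_p - φ_p ψ_q` vanishes at
the zeros of `w_q` for each `x`. With `λ = z²`, the bounds `G = O(exp |Im z| / |z|)` and
`w_q = cos z + O(exp |Im z| / |z|)` show that the entire function `G / w_q` tends to `0` on the
boundaries of the squares `|Re z|, |Im z| < kπ`, so `G = 0` by the maximum principle.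

Differentiating `φ_q ψ_p = φ_p ψ_q` in `x` gives `w_q ψ_p² = w_p ψ_q²`, and `w_q = w_p` at `x = 1`.
For `λ` near `-∞` both `ψ` are positive on `[0,1]`, so they coincide and determine `q` and `b`.
-/

open Filter Topology

namespace MixedSturmLiouville

/-! ### Primitives of integrable functions -/

section Primitive

variable {E : Type*} [NormedAddCommGroup E]

theorem absolutelyContinuousOnInterval_congr {X : Type*} [PseudoMetricSpace X] {u v : ℝ → X}
    {a b : ℝ} (huv : EqOn u v (uIcc a b)) (hu : AbsolutelyContinuousOnInterval u a b) :
    AbsolutelyContinuousOnInterval v a b := by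
  rw [absolutelyContinuousOnInterval_iff] at hu ⊢
  intro ε hε
  obtain ⟨δ, hδ, H⟩ := hu ε hε
  refine ⟨δ, hδ, fun I hI hlen => ?_⟩
  convert H I hI hlen using 2 with i hi
  rw [huv (hI.1 i hi).1, huv (hI.1 i hi).2]

theorem ae_uIcc_mem_nhds (a b : ℝ) : ∀ᵐ x : ℝ, x ∈ uIcc a b → uIcc a b ∈ 𝓝 x := by
  filter_upwards [Measure.ae_ne volume (min a b), Measure.ae_ne volume (max a b)]
    with x hmin hmax hx
  exact Icc_mem_nhds (lt_of_le_of_ne hx.1 hmin.symm) (lt_of_le_of_ne hx.2 hmax)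

variable [NormedSpace ℝ E]

theorem absolutelyContinuousOnInterval_integral {f : ℝ → E} {a b : ℝ}
    (hf : IntervalIntegrable f volume a b) :
    AbsolutelyContinuousOnInterval (fun x => ∫ t in a..x, f t) a b := by
  have hnorm := hf.norm.absolutelyContinuousOnInterval_intervalIntegral (c := a) left_mem_uIcc
  rw [absolutelyContinuousOnInterval_iff] at hnorm ⊢
  intro ε hε
  obtain ⟨δ, hδ, H⟩ := hnorm ε hε
  refine ⟨δ, hδ, fun I hI hlen => (Finset.sum_le_sum fun i hi => ?_).trans_lt (H I hI hlen)⟩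
  have hfst : IntervalIntegrable f volume a (I.2 i).1 :=
    hf.mono_set (uIcc_subset_uIcc_left (hI.1 i hi).1)
  have hsnd : IntervalIntegrable f volume a (I.2 i).2 :=
    hf.mono_set (uIcc_subset_uIcc_left (hI.1 i hi).2)
  rw [dist_eq_norm, dist_eq_norm, intervalIntegral.integral_interval_sub_left hfst hsnd,
    intervalIntegral.integral_interval_sub_left hfst.norm hsnd.norm]
  exact intervalIntegral.norm_integral_le_abs_integral_norm

/-- On the interval with endpoints `a` and `b`, the function `u` is a primitive of the integrable
function `f`. -/
structure IsPrimitive (u f : ℝ → E) (a b : ℝ) : Prop where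
  intervalIntegrable : IntervalIntegrable f volume a b
  eq_add_integral : ∀ x ∈ uIcc a b, u x = u a + ∫ t in a..x, f t

namespace IsPrimitive

variable {u v f g : ℝ → E} {a b : ℝ}

theorem absolutelyContinuousOnInterval (hu : IsPrimitive u f a b) :
    AbsolutelyContinuousOnInterval u a b := by
  have hconst : AbsolutelyContinuousOnInterval (fun _ : ℝ => u a) a b :=
    (LipschitzWith.const (u a)).lipschitzOnWith.absolutelyContinuousOnInterval
  exact absolutelyContinuousOnInterval_congr (fun x hx => (hu.eq_add_integral x hx).symm)
    (hconst.add (absolutelyContinuousOnInterval_integral hu.intervalIntegrable))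

theorem continuousOn (hu : IsPrimitive u f a b) : ContinuousOn u (uIcc a b) :=
  hu.absolutelyContinuousOnInterval.continuousOn

theorem of_integral (hf : IntervalIntegrable f volume a b) :
    IsPrimitive (fun x => ∫ t in a..x, f t) f a b :=
  ⟨hf, fun x _ => by rw [intervalIntegral.integral_same, zero_add]⟩

theorem reflect (hu : IsPrimitive u f a b) :
    IsPrimitive (fun x => u (a + b - x)) (fun x => -f (a + b - x)) a b := by
  have hmaps : ∀ x ∈ uIcc a b, a + b - x ∈ uIcc a b := fun x hx => by
    rw [uIcc, mem_Icc, ← min_add_max a b] at *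
    constructor <;> linarith [hx.1, hx.2]
  have hint : IntervalIntegrable (fun x => f (a + b - x)) volume a b := by
    simpa using (hu.intervalIntegrable.comp_sub_left (a + b)).symm
  refine ⟨hint.neg, fun x hx => ?_⟩
  have hsub : ∫ t in a..x, -f (a + b - t) = -∫ t in (a + b - x)..b, f t := by
    rw [intervalIntegral.integral_neg, intervalIntegral.integral_comp_sub_left,
      add_sub_cancel_left]
  have hadj := intervalIntegral.integral_add_adjacent_intervals
    (hu.intervalIntegrable.mono_set (uIcc_subset_uIcc_left (hmaps x hx)))
    (hu.intervalIntegrable.mono_set (uIcc_subset_uIcc_right (hmaps x hx)))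
  rw [hsub, add_sub_cancel_left, hu.eq_add_integral _ (hmaps x hx),
    hu.eq_add_integral b right_mem_uIcc, ← hadj]
  abel

variable [CompleteSpace E]

theorem ae_hasDerivAt (hu : IsPrimitive u f a b) :
    ∀ᵐ x, x ∈ uIcc a b → HasDerivAt u (f x) x := by
  filter_upwards [hu.intervalIntegrable.ae_hasDerivAt_integral, ae_uIcc_mem_nhds a b]
    with x hderiv hnhds hx
  refine ((hderiv hx a left_mem_uIcc).const_add (u a)).congr_of_eventuallyEq ?_
  filter_upwards [hnhds hx] with y hy using hu.eq_add_integral y hy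

theorem hasDerivWithinAt (hu : IsPrimitive u f a b) (hf : ContinuousOn f (uIcc a b)) {x : ℝ}
    (hx : x ∈ uIcc a b) : HasDerivWithinAt u (f x) (uIcc a b) x := by
  have : Fact (x ∈ Icc (min a b) (max a b)) := ⟨hx⟩
  have hderiv : HasDerivWithinAt (fun y => ∫ t in a..y, f t) (f x) (Icc (min a b) (max a b)) x :=
    intervalIntegral.integral_hasDerivWithinAt_right (t := Icc (min a b) (max a b))
      (hu.intervalIntegrable.mono_set (uIcc_subset_uIcc_left hx))
      (hf.stronglyMeasurableAtFilter_nhdsWithin measurableSet_Icc x) (hf x hx)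
  exact (hderiv.const_add (u a)).congr hu.eq_add_integral (hu.eq_add_integral x hx)

theorem of_absolutelyContinuousOnInterval (hu : AbsolutelyContinuousOnInterval u a b)
    (hf : IntervalIntegrable f volume a b) (hderiv : ∀ᵐ x, x ∈ uIcc a b → HasDerivAt u (f x) x) :
    IsPrimitive u f a b := by
  refine ⟨hf, fun x hx => ?_⟩
  have hderiv_sub : ∀ᵐ y, y ∈ uIcc a b → HasDerivAt (u - fun x => ∫ t in a..x, f t) 0 y := by
    filter_upwards [hderiv, hf.ae_hasDerivAt_integral] with y hy hy' hmem
    simpa using (hy hmem).sub (hy' hmem a left_mem_uIcc)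
  obtain ⟨c, hc⟩ := (hu.sub
    (absolutelyContinuousOnInterval_integral hf)).const_of_ae_hasDerivAt_zero hderiv_sub
  have hca : u a = c := by simpa using hc a left_mem_uIcc
  rw [hca, ← hc x hx]
  exact (sub_add_cancel _ _).symm

theorem of_hasDerivAt (hderiv : ∀ x, HasDerivAt u (f x) x) (hf : Continuous f) :
    IsPrimitive u f a b := by
  refine ⟨hf.intervalIntegrable _ _, fun x _ => ?_⟩
  rw [intervalIntegral.integral_eq_sub_of_hasDerivAt (fun y _ => hderiv y)
    (hf.intervalIntegrable _ _), add_sub_cancel]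

theorem congr (hu : IsPrimitive u f a b) (huv : EqOn u v (uIcc a b))
    (hfg : ∀ᵐ x, x ∈ uIcc a b → f x = g x) : IsPrimitive v g a b := by
  refine .of_absolutelyContinuousOnInterval
    (absolutelyContinuousOnInterval_congr huv hu.absolutelyContinuousOnInterval) ?_ ?_
  · refine hu.intervalIntegrable.congr_ae ((ae_restrict_iff' measurableSet_uIoc).2 ?_)
    filter_upwards [hfg] with x hx hmem using hx (uIoc_subset_uIcc hmem)
  · filter_upwards [hfg, hu.ae_hasDerivAt, ae_uIcc_mem_nhds a b] with x hx hderiv hnhds hmem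
    rw [← hx hmem]
    exact (hderiv hmem).congr_of_eventuallyEq (huv.symm.eventuallyEq_of_mem (hnhds hmem))

theorem clm_comp {F : Type*} [NormedAddCommGroup F] [NormedSpace ℝ F] [CompleteSpace F]
    (L : E →L[ℝ] F) (hu : IsPrimitive u f a b) :
    IsPrimitive (fun x => L (u x)) (fun x => L (f x)) a b := by
  refine ⟨⟨L.integrable_comp hu.intervalIntegrable.1, L.integrable_comp hu.intervalIntegrable.2⟩,
    fun x hx => ?_⟩
  rw [hu.eq_add_integral x hx, map_add, L.intervalIntegral_comp_comm
    (hu.intervalIntegrable.mono_set (uIcc_subset_uIcc_left hx))]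

theorem add (hu : IsPrimitive u f a b) (hv : IsPrimitive v g a b) :
    IsPrimitive (fun x => u x + v x) (fun x => f x + g x) a b := by
  refine .of_absolutelyContinuousOnInterval
    (hu.absolutelyContinuousOnInterval.add hv.absolutelyContinuousOnInterval)
    (hu.intervalIntegrable.add hv.intervalIntegrable) ?_
  filter_upwards [hu.ae_hasDerivAt, hv.ae_hasDerivAt] with x hux hvx hx
    using (hux hx).add (hvx hx)

section Mul

variable {𝕜 : Type*} [RCLike 𝕜] {u v f g : ℝ → 𝕜}

theorem mul (hu : IsPrimitive u f a b) (hv : IsPrimitive v g a b) :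
    IsPrimitive (fun x => u x * v x) (fun x => f x * v x + u x * g x) a b := by
  refine .of_absolutelyContinuousOnInterval
    (hu.absolutelyContinuousOnInterval.smul hv.absolutelyContinuousOnInterval)
    ((hu.intervalIntegrable.mul_continuousOn hv.continuousOn).add
      (hv.intervalIntegrable.continuousOn_mul hu.continuousOn)) ?_
  filter_upwards [hu.ae_hasDerivAt, hv.ae_hasDerivAt] with x hux hvx hx
    using (hux hx).mul (hvx hx)

theorem const_mul (c : 𝕜) (hu : IsPrimitive u f a b) :
    IsPrimitive (fun x => c * u x) (fun x => c * f x) a b := by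
  simpa using (of_hasDerivAt (fun x => hasDerivAt_const x c) continuous_const).mul hu

theorem sub (hu : IsPrimitive u f a b) (hv : IsPrimitive v g a b) :
    IsPrimitive (fun x => u x - v x) (fun x => f x - g x) a b := by
  simpa [sub_eq_add_neg] using hu.add (hv.const_mul (-1))

theorem pow (hu : IsPrimitive u f a b) (n : ℕ) :
    IsPrimitive (fun x => u x ^ (n + 1)) (fun x => (n + 1) * (u x ^ n * f x)) a b := by
  induction n with
  | zero => simpa using hu
  | succ n ih =>
    refine (ih.mul hu).congr (fun x _ => (pow_succ _ _).symm) (Eventually.of_forall fun x _ => ?_)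
    push_cast
    ring

end Mul

end IsPrimitive

end Primitive

/-! ### The initial value problem -/

section Volterra

variable {𝕜 : Type*} [RCLike 𝕜]

theorem isUnit_one_sub_of_norm_pow_lt_one {R : Type*} [NormedRing R] [HasSummableGeomSeries R]
    {a : R} {n : ℕ} (h : ‖a ^ n‖ < 1) : IsUnit (1 - a) := by
  have hcomm : Commute (1 - a) (∑ i ∈ Finset.range n, a ^ i) :=
    (Commute.one_left _).sub_left
      (Commute.sum_right _ _ _ fun i _ => (Commute.refl a).pow_right i)
  have hpow : IsUnit (1 - a ^ n) := isUnit_one_sub_of_norm_lt_one h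
  rw [← mul_neg_geom_sum, hcomm.isUnit_mul_iff] at hpow
  exact hpow.1

theorem differentiable_inverse_one_sub_apply {E : Type*} [NormedAddCommGroup E]
    [NormedSpace 𝕜 E] [CompleteSpace E] {T : 𝕜 → E →L[𝕜] E} (hT : Differentiable 𝕜 T)
    (hunit : ∀ l, IsUnit (1 - T l)) (v : E) :
    Differentiable 𝕜 fun l => Ring.inverse (1 - T l) v := fun l => by
  have hinv : DifferentiableAt 𝕜 (fun l => Ring.inverse (1 - T l)) l :=
    DifferentiableAt.comp (g := Ring.inverse) l (differentiableAt_inverse (hunit l))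
      ((differentiableAt_const _).sub (hT l))
  exact hinv.clm_apply (differentiableAt_const _)

theorem differentiable_mul_sub_smul {E : Type*} [NormedAddCommGroup E] [NormedSpace 𝕜 E]
    (A B C : E →L[𝕜] E) : Differentiable 𝕜 fun l : 𝕜 => A * (B - l • C) := by
  fun_prop

theorem intervalIntegrable_zero_left {E : Type*} [NormedAddCommGroup E] {f : ℝ → E}
    (hf : IntervalIntegrable f volume 0 1) {x : ℝ} (hx : x ∈ Icc (0 : ℝ) 1) :
    IntervalIntegrable f volume 0 x :=
  hf.mono_set (uIcc_subset_uIcc_left (Icc_subset_uIcc hx))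

theorem integral_norm_mono {E : Type*} [NormedAddCommGroup E] {f : ℝ → E}
    (hf : IntervalIntegrable f volume 0 1) :
    MonotoneOn (fun x => ∫ t in (0 : ℝ)..x, ‖f t‖) (Icc 0 1) := fun _ hx _ hy hxy =>
  intervalIntegral.integral_mono_interval le_rfl hx.1 hxy
    (Eventually.of_forall fun _ => norm_nonneg _) (intervalIntegrable_zero_left hf.norm hy)

theorem integral_norm_nonneg {E : Type*} [NormedAddCommGroup E] (f : ℝ → E) {x : ℝ}
    (hx : 0 ≤ x) : 0 ≤ ∫ t in (0 : ℝ)..x, ‖f t‖ :=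
  intervalIntegral.integral_nonneg hx fun _ _ => norm_nonneg _

theorem norm_integral_mul_le {f g : ℝ → 𝕜} {k : ℝ → ℝ} {a b : ℝ} (hab : a ≤ b)
    (hf : IntervalIntegrable f volume a b) (hk : ContinuousOn k (Icc a b))
    (hgk : ∀ t ∈ Icc a b, ‖g t‖ ≤ k t) :
    ‖∫ t in a..b, f t * g t‖ ≤ ∫ t in a..b, ‖f t‖ * k t := by
  refine intervalIntegral.norm_integral_le_of_norm_le hab (Eventually.of_forall fun t ht => ?_)
    (hf.norm.mul_continuousOn (by rwa [uIcc_of_le hab]))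
  rw [norm_mul]
  exact mul_le_mul_of_nonneg_left (hgk t (Ioc_subset_Icc_self ht)) (norm_nonneg _)

theorem integral_mul_integral_pow {f : ℝ → ℝ} {a b : ℝ} (hf : IntervalIntegrable f volume a b)
    (n : ℕ) {x : ℝ} (hx : x ∈ uIcc a b) :
    ∫ t in a..x, f t * (∫ s in a..t, f s) ^ n = (∫ t in a..x, f t) ^ (n + 1) / (n + 1) := by
  have hpow := ((IsPrimitive.of_integral hf).pow n).eq_add_integral x hx
  rw [intervalIntegral.integral_const_mul, intervalIntegral.integral_same,
    zero_pow n.succ_ne_zero, zero_add] at hpow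
  rw [hpow, mul_div_cancel_left₀ _ (by positivity)]
  simp only [mul_comm]

theorem intervalIntegrable_mul_IccExtend {f : ℝ → 𝕜} (hf : IntervalIntegrable f volume 0 1)
    (g : C(Icc (0 : ℝ) 1, 𝕜)) :
    IntervalIntegrable (fun t => f t * IccExtend zero_le_one g t) volume 0 1 :=
  hf.mul_continuousOn g.continuous.Icc_extend'.continuousOn

/-- The operator `g ↦ ∫₀ˣ f g` on `C[0,1]`. -/
noncomputable def volterra {f : ℝ → 𝕜} (hf : IntervalIntegrable f volume 0 1) :
    C(Icc (0 : ℝ) 1, 𝕜) →L[𝕜] C(Icc (0 : ℝ) 1, 𝕜) :=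
  LinearMap.mkContinuous
    { toFun := fun g => ⟨fun x => ∫ t in (0 : ℝ)..x, f t * IccExtend zero_le_one g t,
        (IsPrimitive.of_integral
          (intervalIntegrable_mul_IccExtend hf g)).continuousOn.comp_continuous
            continuous_subtype_val fun x => Icc_subset_uIcc x.2⟩
      map_add' := fun g₁ g₂ => by
        ext x
        simpa [IccExtend, mul_add] using intervalIntegral.integral_add
          (intervalIntegrable_zero_left (intervalIntegrable_mul_IccExtend hf g₁) x.2)
          (intervalIntegrable_zero_left (intervalIntegrable_mul_IccExtend hf g₂) x.2)
      map_smul' := fun c g => by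
        ext x
        simp [IccExtend, mul_left_comm] }
    (∫ t in (0 : ℝ)..1, ‖f t‖)
    (fun g => by
      refine (ContinuousMap.norm_le _ (mul_nonneg (integral_norm_nonneg f zero_le_one)
        (norm_nonneg g))).2 fun x => ?_
      refine (norm_integral_mul_le x.2.1 (intervalIntegrable_zero_left hf x.2)
        (k := fun _ => ‖g‖) continuousOn_const fun t _ => g.norm_coe_le_norm _).trans ?_
      rw [intervalIntegral.integral_mul_const]
      exact mul_le_mul_of_nonneg_right
        (integral_norm_mono hf x.2 (right_mem_Icc.2 zero_le_one) x.2.2) (norm_nonneg _))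

theorem volterra_apply {f : ℝ → 𝕜} (hf : IntervalIntegrable f volume 0 1)
    (g : C(Icc (0 : ℝ) 1, 𝕜)) (x : Icc (0 : ℝ) 1) :
    volterra hf g x = ∫ t in (0 : ℝ)..x, f t * IccExtend zero_le_one g t := rfl

theorem norm_volterra_apply_le {f : ℝ → 𝕜} (hf : IntervalIntegrable f volume 0 1)
    {g : C(Icc (0 : ℝ) 1, 𝕜)} {A : ℝ} {n : ℕ}
    (hg : ∀ t : Icc (0 : ℝ) 1, ‖g t‖ ≤ A * (∫ s in (0 : ℝ)..t, ‖f s‖) ^ n / n.factorial)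
    (x : Icc (0 : ℝ) 1) :
    ‖volterra hf g x‖ ≤ A * (∫ s in (0 : ℝ)..x, ‖f s‖) ^ (n + 1) / (n + 1).factorial := by
  have hcont : ContinuousOn (fun x => ∫ s in (0 : ℝ)..x, ‖f s‖) (Icc 0 1) := by
    simpa using (IsPrimitive.of_integral hf.norm).continuousOn
  calc ‖volterra hf g x‖
      ≤ ∫ t in (0 : ℝ)..x, ‖f t‖ * (A / n.factorial * (∫ s in (0 : ℝ)..t, ‖f s‖) ^ n) := by
        refine norm_integral_mul_le x.2.1 (intervalIntegrable_zero_left hf x.2)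
          (continuousOn_const.mul ((hcont.mono (Icc_subset_Icc_right x.2.2)).pow n))
          fun t ht => ?_
        have ht' : t ∈ Icc (0 : ℝ) 1 := Icc_subset_Icc_right x.2.2 ht
        rw [IccExtend_of_mem _ _ ht', div_mul_eq_mul_div]
        exact hg ⟨t, ht'⟩
    _ = A / n.factorial * ∫ t in (0 : ℝ)..x, ‖f t‖ * (∫ s in (0 : ℝ)..t, ‖f s‖) ^ n := by
        simp only [mul_left_comm, intervalIntegral.integral_const_mul]
    _ = A * (∫ s in (0 : ℝ)..x, ‖f s‖) ^ (n + 1) / (n + 1).factorial := by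
        rw [integral_mul_integral_pow hf.norm n (Icc_subset_uIcc x.2), Nat.factorial_succ]
        push_cast
        field_simp

variable (𝕜) in
/-- The operator `g ↦ ∫₀ˣ g` on `C[0,1]`. -/
noncomputable def integration : C(Icc (0 : ℝ) 1, 𝕜) →L[𝕜] C(Icc (0 : ℝ) 1, 𝕜) :=
  volterra (f := fun _ => 1) intervalIntegrable_const

theorem integration_apply (g : C(Icc (0 : ℝ) 1, 𝕜)) (x : Icc (0 : ℝ) 1) :
    integration 𝕜 g x = ∫ t in (0 : ℝ)..x, IccExtend zero_le_one g t := by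
  simp only [integration, volterra_apply, one_mul]

theorem norm_integration_apply_le {g : C(Icc (0 : ℝ) 1, 𝕜)} {k : ℝ → ℝ}
    (hk : MonotoneOn k (Icc 0 1)) (hgk : ∀ t : Icc (0 : ℝ) 1, ‖g t‖ ≤ k t)
    (x : Icc (0 : ℝ) 1) : ‖integration 𝕜 g x‖ ≤ k x := by
  have hbound : ∀ t ∈ uIoc (0 : ℝ) x, ‖IccExtend zero_le_one g t‖ ≤ k x := fun t ht => by
    rw [uIoc_of_le x.2.1] at ht
    have ht' : t ∈ Icc (0 : ℝ) 1 := ⟨ht.1.le, ht.2.trans x.2.2⟩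
    rw [IccExtend_of_mem _ _ ht']
    exact (hgk ⟨t, ht'⟩).trans (hk ht' x.2 ht.2)
  rw [integration_apply]
  refine (intervalIntegral.norm_integral_le_of_norm_le_const hbound).trans ?_
  rw [sub_zero, abs_of_nonneg x.2.1]
  exact mul_le_of_le_one_right ((norm_nonneg _).trans (hgk x)) x.2.2

end Volterra

section InitialValue

variable {𝕜 : Type*} [RCLike 𝕜] {q : ℝ → 𝕜}

theorem intervalIntegrable_sub_const (hq : IntervalIntegrable q volume 0 1) (l : 𝕜) :
    IntervalIntegrable (fun x => q x - l) volume 0 1 :=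
  hq.sub intervalIntegrable_const

theorem volterra_sub_const (hq : IntervalIntegrable q volume 0 1) (l : 𝕜) :
    volterra (intervalIntegrable_sub_const hq l) = volterra hq - l • integration 𝕜 := by
  ext g x
  change _ = volterra hq g x - l * integration 𝕜 g x
  rw [integration_apply, volterra_apply, volterra_apply, ← intervalIntegral.integral_const_mul,
    ← intervalIntegral.integral_sub
      (intervalIntegrable_zero_left (intervalIntegrable_mul_IccExtend hq g) x.2)
      ((g.continuous.Icc_extend'.intervalIntegrable _ _).const_mul l)]
  simp only [sub_mul]

/-- The operator `g ↦ ∫₀ˣ ∫₀ᵗ (q - l) g` on `C[0,1]`. The solutions of `-y'' + q y = l y` with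
`y(0) = a`, `y'(0) = c` are the fixed points of `g ↦ a + c x + picard hq l g`. -/
noncomputable def picard (hq : IntervalIntegrable q volume 0 1) (l : 𝕜) :
    C(Icc (0 : ℝ) 1, 𝕜) →L[𝕜] C(Icc (0 : ℝ) 1, 𝕜) :=
  integration 𝕜 * volterra (intervalIntegrable_sub_const hq l)

theorem picard_apply (hq : IntervalIntegrable q volume 0 1) (l : 𝕜)
    (g : C(Icc (0 : ℝ) 1, 𝕜)) :
    picard hq l g = integration 𝕜 (volterra (intervalIntegrable_sub_const hq l) g) := rfl

theorem norm_picard_pow_apply_le (hq : IntervalIntegrable q volume 0 1) (l : 𝕜)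
    (g : C(Icc (0 : ℝ) 1, 𝕜)) (n : ℕ) (x : Icc (0 : ℝ) 1) :
    ‖(picard hq l ^ n) g x‖ ≤ ‖g‖ * (∫ t in (0 : ℝ)..x, ‖q t - l‖) ^ n / n.factorial := by
  induction n generalizing x with
  | zero => simpa using g.norm_coe_le_norm x
  | succ n ih =>
    have hmono : MonotoneOn (fun x => ‖g‖ * (∫ t in (0 : ℝ)..x, ‖q t - l‖) ^ (n + 1)
        / (n + 1).factorial) (Icc 0 1) := fun s hs t ht hst => by
      have hle := integral_norm_mono (intervalIntegrable_sub_const hq l) hs ht hst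
      have hnonneg := integral_norm_nonneg (fun t => q t - l) hs.1
      dsimp only at hle ⊢
      gcongr
    rw [pow_succ', mul_apply_eq_comp, picard_apply]
    exact norm_integration_apply_le hmono
      (norm_volterra_apply_le (intervalIntegrable_sub_const hq l) ih) x

theorem isUnit_one_sub_picard (hq : IntervalIntegrable q volume 0 1) (l : 𝕜) :
    IsUnit (1 - picard hq l) := by
  obtain ⟨n, hn⟩ := ((FloorSemiring.tendsto_pow_div_factorial_atTop
    (∫ t in (0 : ℝ)..1, ‖q t - l‖)).eventually_lt_const one_pos).exists
  have hI : 0 ≤ ∫ t in (0 : ℝ)..1, ‖q t - l‖ := integral_norm_nonneg _ zero_le_one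
  refine isUnit_one_sub_of_norm_pow_lt_one
    (R := C(Icc (0 : ℝ) 1, 𝕜) →L[𝕜] C(Icc (0 : ℝ) 1, 𝕜)) (n := n) (lt_of_le_of_lt ?_ hn)
  refine ContinuousLinearMap.opNorm_le_bound _ (by positivity) fun g => ?_
  refine (ContinuousMap.norm_le _ (by positivity)).2 fun x => ?_
  refine (norm_picard_pow_apply_le hq l g n x).trans ?_
  have hle := integral_norm_mono (intervalIntegrable_sub_const hq l) x.2
    (right_mem_Icc.2 zero_le_one) x.2.2
  have hnonneg : 0 ≤ ∫ t in (0 : ℝ)..x, ‖q t - l‖ := integral_norm_nonneg _ x.2.1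
  dsimp only at hle
  rw [mul_div_assoc, mul_comm]
  gcongr

/-- `y` solves `-y'' + q y = l y` on `[0,1]` and `y'` is its derivative. -/
structure IsSolution (q : ℝ → 𝕜) (l : 𝕜) (y y' : ℝ → 𝕜) : Prop where
  isPrimitive : IsPrimitive y y' 0 1
  isPrimitive_deriv : IsPrimitive y' (fun x => (q x - l) * y x) 0 1

namespace IsSolution

variable {l : 𝕜} {y y' : ℝ → 𝕜} {x : ℝ}

theorem eq_add_integral (hy : IsSolution q l y y') (hx : x ∈ Icc (0 : ℝ) 1) :
    y x = y 0 + ∫ t in (0 : ℝ)..x, y' t :=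
  hy.isPrimitive.eq_add_integral x (Icc_subset_uIcc hx)

theorem deriv_eq_add_integral (hy : IsSolution q l y y') (hx : x ∈ Icc (0 : ℝ) 1) :
    y' x = y' 0 + ∫ t in (0 : ℝ)..x, (q t - l) * y t :=
  hy.isPrimitive_deriv.eq_add_integral x (Icc_subset_uIcc hx)

theorem continuousOn (hy : IsSolution q l y y') : ContinuousOn y (Icc 0 1) := by
  simpa using hy.isPrimitive.continuousOn

theorem hasDerivWithinAt (hy : IsSolution q l y y') (hx : x ∈ Icc (0 : ℝ) 1) :
    HasDerivWithinAt y (y' x) (Icc 0 1) x := by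
  simpa using hy.isPrimitive.hasDerivWithinAt hy.isPrimitive_deriv.continuousOn
    (Icc_subset_uIcc hx)

theorem deriv_eqOn {p : ℝ → 𝕜} {k : 𝕜} {z z' : ℝ → 𝕜} (hy : IsSolution q l y y')
    (hz : IsSolution p k z z') (h : EqOn y z (Icc 0 1)) : EqOn y' z' (Icc 0 1) := fun _ hx =>
  (uniqueDiffOn_Icc one_pos _ hx).eq_deriv _ (hy.hasDerivWithinAt hx)
    ((hz.hasDerivWithinAt hx).congr h (h hx))

end IsSolution

/-- The function `a + c x` on `[0,1]`. -/
noncomputable def affine (a c : 𝕜) : C(Icc (0 : ℝ) 1, 𝕜) :=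
  ⟨fun x => a + c * ((x : ℝ) : 𝕜), by fun_prop⟩

theorem affine_apply (a c : 𝕜) (x : Icc (0 : ℝ) 1) : affine a c x = a + c * ((x : ℝ) : 𝕜) := rfl

/-- The solution of `-y'' + q y = l y` with `y(0) = a`, `y'(0) = c`, as an element of `C[0,1]`. -/
noncomputable def solutionMap (hq : IntervalIntegrable q volume 0 1) (a c l : 𝕜) :
    C(Icc (0 : ℝ) 1, 𝕜) :=
  Ring.inverse (1 - picard hq l) (affine a c)

/-- The derivative of `solutionMap`, as an element of `C[0,1]`. -/
noncomputable def solutionDerivMap (hq : IntervalIntegrable q volume 0 1) (a c l : 𝕜) :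
    C(Icc (0 : ℝ) 1, 𝕜) :=
  affine c 0 + volterra (intervalIntegrable_sub_const hq l) (solutionMap hq a c l)

/-- The solution of `-y'' + q y = l y` on `[0,1]` with `y(0) = a`, `y'(0) = c`, extended to `ℝ` by
constants. -/
noncomputable def solution (hq : IntervalIntegrable q volume 0 1) (a c l : 𝕜) : ℝ → 𝕜 :=
  IccExtend zero_le_one (solutionMap hq a c l)

/-- The derivative of `solution` on `[0,1]`, extended to `ℝ` by constants. -/
noncomputable def solutionDeriv (hq : IntervalIntegrable q volume 0 1) (a c l : 𝕜) : ℝ → 𝕜 :=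
  IccExtend zero_le_one (solutionDerivMap hq a c l)

theorem eq_solutionMap_iff (hq : IntervalIntegrable q volume 0 1) {a c l : 𝕜}
    {g : C(Icc (0 : ℝ) 1, 𝕜)} :
    g = solutionMap hq a c l ↔ g = affine a c + picard hq l g := by
  have hunit := isUnit_one_sub_picard hq l
  have hsub : g = affine a c + picard hq l g ↔ (1 - picard hq l) g = affine a c := by
    rw [← sub_eq_iff_eq_add]
    rfl
  rw [hsub, solutionMap]
  constructor
  · rintro rfl
    rw [← mul_apply_eq_comp, Ring.mul_inverse_cancel _ hunit, one_apply_eq_self]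
  · intro hg
    rw [← hg, ← mul_apply_eq_comp, Ring.inverse_mul_cancel _ hunit, one_apply_eq_self]

theorem continuous_solution (hq : IntervalIntegrable q volume 0 1) (a c l : 𝕜) :
    Continuous (solution hq a c l) :=
  (solutionMap hq a c l).continuous.Icc_extend'

theorem continuous_solutionDeriv (hq : IntervalIntegrable q volume 0 1) (a c l : 𝕜) :
    Continuous (solutionDeriv hq a c l) :=
  (solutionDerivMap hq a c l).continuous.Icc_extend'

theorem solutionDeriv_eq (hq : IntervalIntegrable q volume 0 1) (a c l : 𝕜) {x : ℝ}
    (hx : x ∈ Icc (0 : ℝ) 1) :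
    solutionDeriv hq a c l x = c + ∫ t in (0 : ℝ)..x, (q t - l) * solution hq a c l t := by
  rw [solutionDeriv, IccExtend_of_mem _ _ hx, solutionDerivMap, ContinuousMap.add_apply,
    affine_apply, volterra_apply, zero_mul, add_zero, solution]

theorem solution_eq (hq : IntervalIntegrable q volume 0 1) (a c l : 𝕜) {x : ℝ}
    (hx : x ∈ Icc (0 : ℝ) 1) :
    solution hq a c l x = a + ∫ t in (0 : ℝ)..x, solutionDeriv hq a c l t := by
  have hderiv : ∀ t, solutionDeriv hq a c l t = c + IccExtend zero_le_one
      (volterra (intervalIntegrable_sub_const hq l) (solutionMap hq a c l)) t := fun t => by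
    simp [solutionDeriv, IccExtend, solutionDerivMap, affine_apply]
  have hcont := (volterra (intervalIntegrable_sub_const hq l)
    (solutionMap hq a c l)).continuous.Icc_extend' (h := zero_le_one)
  rw [solution, IccExtend_of_mem _ _ hx, (eq_solutionMap_iff hq).1 rfl, ContinuousMap.add_apply,
    picard_apply, integration_apply, affine_apply]
  simp_rw [hderiv]
  rw [intervalIntegral.integral_add intervalIntegrable_const (hcont.intervalIntegrable _ _),
    intervalIntegral.integral_const, sub_zero, RCLike.real_smul_eq_coe_mul]
  ring

theorem solution_zero (hq : IntervalIntegrable q volume 0 1) (a c l : 𝕜) :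
    solution hq a c l 0 = a := by
  rw [solution_eq hq a c l (left_mem_Icc.2 zero_le_one), intervalIntegral.integral_same, add_zero]

theorem solutionDeriv_zero (hq : IntervalIntegrable q volume 0 1) (a c l : 𝕜) :
    solutionDeriv hq a c l 0 = c := by
  rw [solutionDeriv_eq hq a c l (left_mem_Icc.2 zero_le_one), intervalIntegral.integral_same,
    add_zero]

theorem isSolution_solution (hq : IntervalIntegrable q volume 0 1) (a c l : 𝕜) :
    IsSolution q l (solution hq a c l) (solutionDeriv hq a c l) where
  isPrimitive := by
    refine ⟨(continuous_solutionDeriv hq a c l).intervalIntegrable _ _, fun x hx => ?_⟩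
    rw [uIcc_of_le zero_le_one] at hx
    rw [solution_zero, solution_eq hq a c l hx]
  isPrimitive_deriv := by
    refine ⟨(intervalIntegrable_sub_const hq l).mul_continuousOn
      (continuous_solution hq a c l).continuousOn, fun x hx => ?_⟩
    rw [uIcc_of_le zero_le_one] at hx
    rw [solutionDeriv_zero, solutionDeriv_eq hq a c l hx]

theorem IsSolution.eqOn_solution (hq : IntervalIntegrable q volume 0 1) {l : 𝕜} {y y' : ℝ → 𝕜}
    (hy : IsSolution q l y y') : EqOn y (solution hq (y 0) (y' 0) l) (Icc 0 1) := by
  set g : C(Icc (0 : ℝ) 1, 𝕜) := ⟨(Icc 0 1).domRestrict y, hy.continuousOn.domRestrict⟩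
  have hg : ∀ t ∈ Icc (0 : ℝ) 1, IccExtend zero_le_one g t = y t := fun t ht =>
    IccExtend_of_mem _ _ ht
  have hvolterra : ∀ t ∈ Icc (0 : ℝ) 1, IccExtend zero_le_one
      (volterra (intervalIntegrable_sub_const hq l) g) t = y' t - y' 0 := fun t ht => by
    rw [IccExtend_of_mem _ _ ht, volterra_apply, hy.deriv_eq_add_integral ht, add_sub_cancel_left]
    refine intervalIntegral.integral_congr fun s hs => ?_
    rw [uIcc_of_le ht.1] at hs
    exact congrArg _ (hg s ⟨hs.1, hs.2.trans ht.2⟩)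
  have hfix : g = affine (y 0) (y' 0) + picard hq l g := by
    ext x
    have hint : ∫ t in (0 : ℝ)..x, IccExtend zero_le_one
        (volterra (intervalIntegrable_sub_const hq l) g) t = ∫ t in (0 : ℝ)..x, (y' t - y' 0) :=
      intervalIntegral.integral_congr fun t ht => by
        rw [uIcc_of_le x.2.1] at ht
        exact hvolterra t ⟨ht.1, ht.2.trans x.2.2⟩
    rw [ContinuousMap.add_apply, picard_apply, integration_apply, affine_apply, hint,
      intervalIntegral.integral_sub
        (intervalIntegrable_zero_left hy.isPrimitive.intervalIntegrable x.2)
        intervalIntegrable_const, intervalIntegral.integral_const, sub_zero,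
      RCLike.real_smul_eq_coe_mul]
    refine (hy.eq_add_integral x.2).trans ?_
    ring
  intro x hx
  rw [solution, ← (eq_solutionMap_iff hq).2 hfix, hg x hx]

theorem differentiable_picard (hq : IntervalIntegrable q volume 0 1) :
    Differentiable 𝕜 (picard hq) := by
  have heq : picard hq = fun l => integration 𝕜 * (volterra hq - l • integration 𝕜) :=
    funext fun l => by rw [picard, volterra_sub_const]
  rw [heq]
  exact differentiable_mul_sub_smul _ _ _

theorem differentiable_solutionMap (hq : IntervalIntegrable q volume 0 1) (a c : 𝕜) :
    Differentiable 𝕜 (solutionMap hq a c) :=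
  differentiable_inverse_one_sub_apply (differentiable_picard hq) (isUnit_one_sub_picard hq) _

theorem differentiable_solutionDerivMap (hq : IntervalIntegrable q volume 0 1) (a c : 𝕜) :
    Differentiable 𝕜 (solutionDerivMap hq a c) := by
  have hsol := differentiable_solutionMap hq a c
  have heq : solutionDerivMap hq a c = fun l =>
      affine c 0 + (volterra hq - l • integration 𝕜) (solutionMap hq a c l) :=
    funext fun l => by rw [solutionDerivMap, volterra_sub_const]
  rw [heq]
  fun_prop

theorem differentiable_solution (hq : IntervalIntegrable q volume 0 1) (a c : 𝕜) (x : ℝ) :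
    Differentiable 𝕜 fun l => solution hq a c l x :=
  let eval : C(Icc (0 : ℝ) 1, 𝕜) →L[𝕜] 𝕜 :=
    ContinuousMap.evalCLM 𝕜 (projIcc 0 1 zero_le_one x)
  eval.differentiable.comp (differentiable_solutionMap hq a c)

theorem differentiable_solutionDeriv (hq : IntervalIntegrable q volume 0 1) (a c : 𝕜) (x : ℝ) :
    Differentiable 𝕜 fun l => solutionDeriv hq a c l x :=
  let eval : C(Icc (0 : ℝ) 1, 𝕜) →L[𝕜] 𝕜 :=
    ContinuousMap.evalCLM 𝕜 (projIcc 0 1 zero_le_one x)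
  eval.differentiable.comp (differentiable_solutionDerivMap hq a c)

end InitialValue

/-! ### The characteristic function -/

section Characteristic

variable {𝕜 : Type*} [RCLike 𝕜] {q : ℝ → 𝕜}

theorem intervalIntegrable_reflect (hq : IntervalIntegrable q volume 0 1) :
    IntervalIntegrable (fun x => q (1 - x)) volume 0 1 := by
  simpa using (hq.comp_sub_left 1).symm

namespace IsSolution

variable {l m : 𝕜} {y y' u u' : ℝ → 𝕜}

theorem reflect (hy : IsSolution q l y y') :
    IsSolution (fun x => q (1 - x)) l (fun x => y (1 - x)) (fun x => -y' (1 - x)) where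
  isPrimitive := by simpa using hy.isPrimitive.reflect
  isPrimitive_deriv := by simpa using hy.isPrimitive_deriv.reflect.const_mul (-1)

theorem const_mul (a : 𝕜) (hy : IsSolution q l y y') :
    IsSolution q l (fun x => a * y x) (fun x => a * y' x) where
  isPrimitive := hy.isPrimitive.const_mul a
  isPrimitive_deriv := by simpa [mul_left_comm] using hy.isPrimitive_deriv.const_mul a

theorem eqOn_of_eq_one (hq : IntervalIntegrable q volume 0 1) (hy : IsSolution q l y y')
    (hu : IsSolution q l u u') (h : y 1 = u 1) (h' : y' 1 = u' 1) : EqOn y u (Icc 0 1) :=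
  fun x hx => by
    have hx' : 1 - x ∈ Icc (0 : ℝ) 1 := ⟨sub_nonneg.2 hx.2, sub_le_self _ hx.1⟩
    have hyx := hy.reflect.eqOn_solution (intervalIntegrable_reflect hq) hx'
    have hux := hu.reflect.eqOn_solution (intervalIntegrable_reflect hq) hx'
    simp only [sub_sub_cancel, sub_zero, h, h'] at hyx hux
    rw [hyx, hux]

theorem wronskian_eq (hy : IsSolution q l y y') (hu : IsSolution q m u u') {x : ℝ}
    (hx : x ∈ Icc (0 : ℝ) 1) :
    y x * u' x - y' x * u x
      = y 0 * u' 0 - y' 0 * u 0 + (l - m) * ∫ t in (0 : ℝ)..x, y t * u t := by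
  have h : IsPrimitive (fun x => y x * u' x - y' x * u x) (fun x => (l - m) * (y x * u x)) 0 1 :=
    ((hy.isPrimitive.mul hu.isPrimitive_deriv).sub
      (hy.isPrimitive_deriv.mul hu.isPrimitive)).congr (fun _ _ => rfl)
      (Eventually.of_forall fun t _ => by ring)
  rw [h.eq_add_integral x (Icc_subset_uIcc hx), intervalIntegral.integral_const_mul]

end IsSolution

/-- The solution `φ` of `-φ'' + q φ = l φ` with `φ(0) = 0`, `φ'(0) = 1`. -/
noncomputable def varphi (hq : IntervalIntegrable q volume 0 1) (l : 𝕜) : ℝ → 𝕜 :=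
  solution hq 0 1 l

/-- The derivative of `varphi`. -/
noncomputable def varphiDeriv (hq : IntervalIntegrable q volume 0 1) (l : 𝕜) : ℝ → 𝕜 :=
  solutionDeriv hq 0 1 l

/-- The solution `ψ` of `-ψ'' + q ψ = l ψ` with `ψ(1) = 1`, `ψ'(1) = -b`, which satisfies the
boundary condition at `1`. -/
noncomputable def psi (hq : IntervalIntegrable q volume 0 1) (b l : 𝕜) : ℝ → 𝕜 :=
  fun x => solution (intervalIntegrable_reflect hq) 1 b l (1 - x)

/-- The derivative of `psi`. -/
noncomputable def psiDeriv (hq : IntervalIntegrable q volume 0 1) (b l : 𝕜) : ℝ → 𝕜 :=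
  fun x => -solutionDeriv (intervalIntegrable_reflect hq) 1 b l (1 - x)

/-- The characteristic function `φ'(1, l) + b φ(1, l)`, whose zeros are the eigenvalues. -/
noncomputable def charFun (hq : IntervalIntegrable q volume 0 1) (b l : 𝕜) : 𝕜 :=
  varphiDeriv hq l 1 + b * varphi hq l 1

variable (hq : IntervalIntegrable q volume 0 1)

theorem varphi_zero (l : 𝕜) : varphi hq l 0 = 0 := solution_zero hq 0 1 l

theorem varphiDeriv_zero (l : 𝕜) : varphiDeriv hq l 0 = 1 := solutionDeriv_zero hq 0 1 l

theorem isSolution_varphi (l : 𝕜) : IsSolution q l (varphi hq l) (varphiDeriv hq l) :=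
  isSolution_solution hq 0 1 l

theorem continuous_varphi (l : 𝕜) : Continuous (varphi hq l) := continuous_solution hq 0 1 l

theorem differentiable_varphi (x : ℝ) : Differentiable 𝕜 fun l => varphi hq l x :=
  differentiable_solution hq 0 1 x

theorem psi_one (b l : 𝕜) : psi hq b l 1 = 1 := by simp [psi, solution_zero]

theorem psiDeriv_one (b l : 𝕜) : psiDeriv hq b l 1 = -b := by simp [psiDeriv, solutionDeriv_zero]

theorem isSolution_psi (b l : 𝕜) : IsSolution q l (psi hq b l) (psiDeriv hq b l) := by
  have h := (isSolution_solution (intervalIntegrable_reflect hq) 1 b l).reflect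
  simp only [sub_sub_cancel] at h
  exact h

theorem differentiable_psi (b : 𝕜) (x : ℝ) : Differentiable 𝕜 fun l => psi hq b l x :=
  differentiable_solution _ 1 b (1 - x)

theorem differentiable_charFun (b : 𝕜) : Differentiable 𝕜 (charFun hq b) :=
  (differentiable_solutionDeriv hq 0 1 1).add ((differentiable_varphi hq 1).const_mul b)

theorem wronskian_varphi_psi (b l : 𝕜) {x : ℝ} (hx : x ∈ Icc (0 : ℝ) 1) :
    varphiDeriv hq l x * psi hq b l x - varphi hq l x * psiDeriv hq b l x = charFun hq b l := by
  have hwronskian := fun {x : ℝ} (hx : x ∈ Icc (0 : ℝ) 1) =>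
    (isSolution_varphi hq l).wronskian_eq (isSolution_psi hq b l) hx
  simp only [sub_self, zero_mul, add_zero] at hwronskian
  have hone := hwronskian (right_mem_Icc.2 zero_le_one)
  rw [psi_one, psiDeriv_one] at hone
  rw [charFun]
  linear_combination hone - hwronskian hx

theorem charFun_eq_psi_zero (b l : 𝕜) : charFun hq b l = psi hq b l 0 := by
  rw [← wronskian_varphi_psi hq b l (left_mem_Icc.2 zero_le_one), varphi_zero, varphiDeriv_zero]
  ring

theorem eqOn_varphi_mul_psi {b l : 𝕜} (hl : charFun hq b l = 0) :
    EqOn (varphi hq l) (fun x => varphi hq l 1 * psi hq b l x) (Icc 0 1) := by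
  refine (isSolution_varphi hq l).eqOn_of_eq_one hq ((isSolution_psi hq b l).const_mul _) ?_ ?_
  · rw [psi_one, mul_one]
  · rw [charFun] at hl
    rw [psiDeriv_one]
    linear_combination hl

theorem exists_varphi_ne_zero (l : 𝕜) : ∃ x ∈ Icc (0 : ℝ) 1, varphi hq l x ≠ 0 := by
  by_contra! hzero
  have hsol := isSolution_varphi hq l
  have hderiv := hsol.deriv_eqOn (hsol.const_mul 0)
    (fun x hx => (hzero x hx).trans (zero_mul _).symm) (left_mem_Icc.2 zero_le_one)
  simp [varphiDeriv_zero] at hderiv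

theorem differentiable_integral_mul_varphi {f : ℝ → 𝕜} (hf : IntervalIntegrable f volume 0 1) :
    Differentiable 𝕜 fun l => ∫ t in (0 : ℝ)..1, f t * varphi hq l t :=
  let eval : C(Icc (0 : ℝ) 1, 𝕜) →L[𝕜] 𝕜 := ContinuousMap.evalCLM 𝕜 ⟨1, by simp⟩
  (eval ∘L volterra hf).differentiable.comp (differentiable_solutionMap hq 0 1)

theorem varphi_mul_charFun {b l : 𝕜} (hl : charFun hq b l = 0) (m : 𝕜) :
    varphi hq l 1 * charFun hq b m
      = (l - m) * ∫ t in (0 : ℝ)..1, varphi hq l t * varphi hq m t := by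
  have hwronskian := (isSolution_varphi hq l).wronskian_eq (isSolution_varphi hq m)
    (right_mem_Icc.2 zero_le_one)
  simp only [varphi_zero, varphiDeriv_zero] at hwronskian
  rw [charFun] at hl ⊢
  linear_combination hwronskian + varphi hq m 1 * hl

theorem varphi_mul_deriv_charFun {b l : 𝕜} (hl : charFun hq b l = 0) :
    varphi hq l 1 * deriv (charFun hq b) l
      = -∫ t in (0 : ℝ)..1, varphi hq l t * varphi hq l t := by
  have hleft : HasDerivAt (fun m => varphi hq l 1 * charFun hq b m)
      (varphi hq l 1 * deriv (charFun hq b) l) l :=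
    (differentiable_charFun hq b l).hasDerivAt.const_mul _
  have hint := differentiable_integral_mul_varphi hq
    ((continuous_varphi hq l).intervalIntegrable 0 1) l
  have hright := ((hasDerivAt_id l).const_sub l).mul hint.hasDerivAt
  simp_rw [varphi_mul_charFun hq hl] at hleft
  simpa using hleft.unique hright

end Characteristic

/-! ### Real potentials -/

section RealPotential

open ComplexConjugate

theorem intervalIntegrable_ofReal {q : ℝ → ℝ} (hq : IntervalIntegrable q volume 0 1) :
    IntervalIntegrable (fun x => (q x : ℂ)) volume 0 1 :=
  ⟨hq.1.ofReal, hq.2.ofReal⟩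

variable {q : ℝ → ℝ}

namespace IsSolution

theorem ofReal {r : ℝ} {y y' : ℝ → ℝ} (hy : IsSolution q r y y') :
    IsSolution (fun x => (q x : ℂ)) r (fun x => (y x : ℂ)) (fun x => (y' x : ℂ)) where
  isPrimitive := hy.isPrimitive.clm_comp Complex.ofRealCLM
  isPrimitive_deriv := by simpa using hy.isPrimitive_deriv.clm_comp Complex.ofRealCLM

theorem conjugate {l : ℂ} {y y' : ℝ → ℂ} (hy : IsSolution (fun x => (q x : ℂ)) l y y') :
    IsSolution (fun x => (q x : ℂ)) (conj l) (fun x => conj (y x)) (fun x => conj (y' x)) where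
  isPrimitive := by simpa using hy.isPrimitive.clm_comp Complex.conjCLE.toContinuousLinearMap
  isPrimitive_deriv := by
    simpa using hy.isPrimitive_deriv.clm_comp Complex.conjCLE.toContinuousLinearMap

end IsSolution

variable (hq : IntervalIntegrable q volume 0 1)

theorem solution_ofReal (a c r : ℝ) {x : ℝ} (hx : x ∈ Icc (0 : ℝ) 1) :
    solution (intervalIntegrable_ofReal hq) (a : ℂ) c r x = solution hq a c r x := by
  have h := (isSolution_solution hq a c r).ofReal.eqOn_solution (intervalIntegrable_ofReal hq) hx
  rw [solution_zero, solutionDeriv_zero] at h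
  exact h.symm

theorem varphi_ofReal (r : ℝ) {x : ℝ} (hx : x ∈ Icc (0 : ℝ) 1) :
    varphi (intervalIntegrable_ofReal hq) (r : ℂ) x = varphi hq r x := by
  simpa [varphi] using solution_ofReal hq 0 1 r hx

theorem psi_ofReal (b r : ℝ) {x : ℝ} (hx : x ∈ Icc (0 : ℝ) 1) :
    psi (intervalIntegrable_ofReal hq) (b : ℂ) r x = psi hq b r x := by
  simpa [psi] using solution_ofReal (intervalIntegrable_reflect hq) 1 b r (x := 1 - x)
    ⟨sub_nonneg.2 hx.2, sub_le_self _ hx.1⟩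

theorem charFun_ofReal (b r : ℝ) :
    charFun (intervalIntegrable_ofReal hq) (b : ℂ) r = charFun hq b r := by
  rw [charFun_eq_psi_zero, charFun_eq_psi_zero, psi_ofReal hq b r (left_mem_Icc.2 zero_le_one)]

theorem deriv_charFun_ofReal (b r : ℝ) :
    deriv (charFun (intervalIntegrable_ofReal hq) (b : ℂ)) r = deriv (charFun hq b) r := by
  have hcomplex := (differentiable_charFun (intervalIntegrable_ofReal hq) (b : ℂ)
    r).hasDerivAt.comp_ofReal
  simp only [charFun_ofReal hq] at hcomplex
  exact hcomplex.unique (differentiable_charFun hq b r).hasDerivAt.ofReal_comp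

theorem varphi_mul_deriv_charFun_neg {b r : ℝ} (hr : charFun hq b r = 0) :
    varphi hq r 1 * deriv (charFun hq b) r < 0 := by
  rw [varphi_mul_deriv_charFun hq hr, neg_lt_zero]
  obtain ⟨x, hx, hne⟩ := exists_varphi_ne_zero hq r
  exact intervalIntegral.integral_pos one_pos
    ((continuous_varphi hq r).mul (continuous_varphi hq r)).continuousOn
    (fun t _ => mul_self_nonneg _) ⟨x, hx, mul_self_pos.2 hne⟩

theorem varphi_one_ne_zero {b r : ℝ} (hr : charFun hq b r = 0) : varphi hq r 1 ≠ 0 :=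
  left_ne_zero_of_mul (varphi_mul_deriv_charFun_neg hq hr).ne

theorem deriv_charFun_ne_zero {b r : ℝ} (hr : charFun hq b r = 0) : deriv (charFun hq b) r ≠ 0 :=
  right_ne_zero_of_mul (varphi_mul_deriv_charFun_neg hq hr).ne

theorem deriv_charFun_ofReal_ne_zero {b r : ℝ} (hr : charFun hq b r = 0) :
    deriv (charFun (intervalIntegrable_ofReal hq) (b : ℂ)) r ≠ 0 := by
  rw [deriv_charFun_ofReal hq, Complex.ofReal_ne_zero]
  exact deriv_charFun_ne_zero hq hr

theorem integral_normSq_varphi_pos (l : ℂ) :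
    0 < ∫ t in (0 : ℝ)..1, Complex.normSq (varphi (intervalIntegrable_ofReal hq) l t) := by
  obtain ⟨x, hx, hne⟩ := exists_varphi_ne_zero (intervalIntegrable_ofReal hq) l
  exact intervalIntegral.integral_pos one_pos
    (Complex.continuous_normSq.comp (continuous_varphi _ l)).continuousOn
    (fun t _ => Complex.normSq_nonneg _) ⟨x, hx, Complex.normSq_pos.2 hne⟩

theorem im_eq_zero_of_charFun_eq_zero {b : ℝ} {l : ℂ}
    (hl : charFun (intervalIntegrable_ofReal hq) (b : ℂ) l = 0) : l.im = 0 := by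
  have hsol := isSolution_varphi (intervalIntegrable_ofReal hq) l
  have hderiv : varphiDeriv (intervalIntegrable_ofReal hq) l 1
      = -b * varphi (intervalIntegrable_ofReal hq) l 1 := by
    rw [charFun] at hl
    linear_combination hl
  have hwronskian := hsol.wronskian_eq hsol.conjugate (right_mem_Icc.2 zero_le_one)
  simp only [varphi_zero, hderiv, map_mul, map_neg, Complex.conj_ofReal, map_zero,
    Complex.mul_conj, intervalIntegral.integral_ofReal] at hwronskian
  have hmul : (l - conj l) * ((∫ t in (0 : ℝ)..1,
      Complex.normSq (varphi (intervalIntegrable_ofReal hq) l t) : ℝ) : ℂ) = 0 := by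
    linear_combination -hwronskian
  rcases mul_eq_zero.1 hmul with hconj | hint
  · exact Complex.conj_eq_iff_im.1 (sub_eq_zero.1 hconj).symm
  · exact absurd (Complex.ofReal_eq_zero.1 hint) (integral_normSq_varphi_pos hq l).ne'

end RealPotential

/-! ### Asymptotics for large spectral parameter -/

section Asymptotics

open Asymptotics

theorem norm_exp_mul_I_le (w : ℂ) : ‖Complex.exp (w * Complex.I)‖ ≤ Real.exp |w.im| := by
  rw [Complex.norm_exp, Real.exp_le_exp]
  simpa using neg_le_abs w.im

theorem norm_exp_neg_mul_I_le (w : ℂ) : ‖Complex.exp (-w * Complex.I)‖ ≤ Real.exp |w.im| := by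
  simpa using norm_exp_mul_I_le (-w)

theorem norm_cos_le (w : ℂ) : ‖Complex.cos w‖ ≤ Real.exp |w.im| := by
  rw [Complex.cos, norm_div, Complex.norm_ofNat]
  linarith [norm_add_le (Complex.exp (w * Complex.I)) (Complex.exp (-w * Complex.I)),
    norm_exp_mul_I_le w, norm_exp_neg_mul_I_le w]

theorem norm_sin_le (w : ℂ) : ‖Complex.sin w‖ ≤ Real.exp |w.im| := by
  rw [Complex.sin, norm_div, Complex.norm_ofNat, norm_mul, Complex.norm_I, mul_one]
  linarith [norm_sub_le (Complex.exp (-w * Complex.I)) (Complex.exp (w * Complex.I)),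
    norm_exp_mul_I_le w, norm_exp_neg_mul_I_le w]

theorem abs_im_mul_ofReal (z : ℂ) {x : ℝ} (hx : 0 ≤ x) : |(z * x).im| = |z.im| * x := by
  simp [abs_mul, abs_of_nonneg hx]

variable {q : ℝ → ℂ}

namespace IsSolution

variable {y y' : ℝ → ℂ} {z : ℂ}

theorem variation_of_parameters (hy : IsSolution q (z ^ 2) y y') (hz : z ≠ 0) {x : ℝ}
    (hx : x ∈ Icc (0 : ℝ) 1) :
    y x = y 0 * Complex.cos (z * x) + y' 0 * (Complex.sin (z * x) / z)
      + ∫ t in (0 : ℝ)..x, q t * (Complex.sin (z * (x - t : ℝ)) / z * y t) := by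
  have hinner : ∀ t : ℝ, HasDerivAt (fun t : ℝ => z * ((x - t : ℝ) : ℂ)) (-z) t := fun t => by
    simpa using (((hasDerivAt_id t).const_sub x).ofReal_comp).const_mul z
  have hsin : IsPrimitive (fun t : ℝ => Complex.sin (z * (x - t : ℝ)) / z)
      (fun t : ℝ => -Complex.cos (z * (x - t : ℝ))) 0 1 :=
    .of_hasDerivAt (fun t =>
      (((Complex.hasDerivAt_sin _).comp t (hinner t)).div_const z).congr_deriv (by field_simp))
      (by fun_prop)
  have hcos : IsPrimitive (fun t : ℝ => Complex.cos (z * (x - t : ℝ)))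
      (fun t : ℝ => z * Complex.sin (z * (x - t : ℝ))) 0 1 :=
    .of_hasDerivAt (fun t => ((Complex.hasDerivAt_cos _).comp t (hinner t)).congr_deriv (by ring))
      (by fun_prop)
  -- Integrate the derivative of `y' t sin z(x - t) / z + y t cos z(x - t)` from `0` to `x`.
  have hsum := ((hsin.mul hy.isPrimitive_deriv).add (hcos.mul hy.isPrimitive)).congr
    (g := fun t => q t * (Complex.sin (z * (x - t : ℝ)) / z * y t)) (fun _ _ => rfl)
    (Eventually.of_forall fun t _ => by field_simp; ring)
  have heq := hsum.eq_add_integral x (Icc_subset_uIcc hx)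
  simp only [sub_self, sub_zero, Complex.ofReal_zero, mul_zero, Complex.sin_zero, zero_div,
    zero_mul, Complex.cos_zero, one_mul, zero_add] at heq
  rw [heq]
  ring

theorem norm_sub_cos_le (hq : IntervalIntegrable q volume 0 1) (hy : IsSolution q (z ^ 2) y y')
    (hz : z ≠ 0) {M : ℝ} (hM : ∀ t ∈ Icc (0 : ℝ) 1, ‖y t‖ ≤ M * Real.exp (|z.im| * t)) {x : ℝ}
    (hx : x ∈ Icc (0 : ℝ) 1) :
    ‖y x - y 0 * Complex.cos (z * x)‖
      ≤ (‖y' 0‖ + M * ∫ t in (0 : ℝ)..1, ‖q t‖) * (Real.exp (|z.im| * x) / ‖z‖) := by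
  have hM0 : 0 ≤ M := by simpa using (norm_nonneg _).trans (hM 0 (left_mem_Icc.2 zero_le_one))
  have hsin : ∀ {s : ℝ}, 0 ≤ s →
      ‖Complex.sin (z * s) / z‖ ≤ Real.exp (|z.im| * s) / ‖z‖ := fun hs => by
    rw [norm_div, ← abs_im_mul_ofReal z hs]
    exact div_le_div_of_nonneg_right (norm_sin_le _) (norm_nonneg z)
  have hkernel : ∀ t ∈ Icc 0 x, ‖Complex.sin (z * (x - t : ℝ)) / z * y t‖
      ≤ M * (Real.exp (|z.im| * x) / ‖z‖) := fun t ht => by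
    have hexp : Real.exp (|z.im| * (x - t)) * Real.exp (|z.im| * t) = Real.exp (|z.im| * x) := by
      rw [← Real.exp_add]
      ring_nf
    rw [norm_mul]
    calc _ ≤ Real.exp (|z.im| * (x - t)) / ‖z‖ * (M * Real.exp (|z.im| * t)) :=
          mul_le_mul (hsin (sub_nonneg.2 ht.2)) (hM t ⟨ht.1, ht.2.trans hx.2⟩)
            (norm_nonneg _) (by positivity)
      _ = M * (Real.exp (|z.im| * x) / ‖z‖) := by rw [← hexp]; ring
  have hintegral : ‖∫ t in (0 : ℝ)..x, q t * (Complex.sin (z * (x - t : ℝ)) / z * y t)‖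
      ≤ (∫ t in (0 : ℝ)..1, ‖q t‖) * (M * (Real.exp (|z.im| * x) / ‖z‖)) := by
    refine (norm_integral_mul_le hx.1 (intervalIntegrable_zero_left hq hx) continuousOn_const
      hkernel).trans ?_
    rw [intervalIntegral.integral_mul_const]
    exact mul_le_mul_of_nonneg_right
      (integral_norm_mono hq hx (right_mem_Icc.2 zero_le_one) hx.2) (by positivity)
  rw [hy.variation_of_parameters hz hx, add_assoc, add_sub_cancel_left]
  refine (norm_add_le _ _).trans ?_
  rw [norm_mul, add_mul]
  refine add_le_add (mul_le_mul_of_nonneg_left (hsin hx.1) (norm_nonneg _)) (hintegral.trans_eq ?_)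
  ring

theorem norm_le (hq : IntervalIntegrable q volume 0 1) (hy : IsSolution q (z ^ 2) y y')
    (hz : 1 ≤ ‖z‖) (hzq : 2 * (∫ t in (0 : ℝ)..1, ‖q t‖) ≤ ‖z‖) {x : ℝ}
    (hx : x ∈ Icc (0 : ℝ) 1) :
    ‖y x‖ ≤ 2 * (‖y 0‖ + ‖y' 0‖) * Real.exp (|z.im| * x) := by
  have hz0 : 0 < ‖z‖ := one_pos.trans_le hz
  have hcont : ContinuousOn (fun t => ‖y t‖ / Real.exp (|z.im| * t)) (Icc 0 1) :=
    hy.continuousOn.norm.div (by fun_prop) fun t _ => (Real.exp_pos _).ne'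
  obtain ⟨s, hs, hmax⟩ := isCompact_Icc.exists_isMaxOn (nonempty_Icc.2 zero_le_one) hcont
  set M := ‖y s‖ / Real.exp (|z.im| * s)
  have hM : ∀ t ∈ Icc (0 : ℝ) 1, ‖y t‖ ≤ M * Real.exp (|z.im| * t) := fun t ht =>
    (div_le_iff₀ (Real.exp_pos _)).1 (hmax ht)
  have hcos := norm_cos_le (z * s)
  rw [abs_im_mul_ofReal z hs.1] at hcos
  have hle : M ≤ ‖y 0‖ + (‖y' 0‖ + M * ∫ t in (0 : ℝ)..1, ‖q t‖) / ‖z‖ := by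
    refine (div_le_iff₀ (Real.exp_pos _)).2 ?_
    calc ‖y s‖ ≤ ‖y 0 * Complex.cos (z * s)‖ + ‖y s - y 0 * Complex.cos (z * s)‖ :=
          norm_le_norm_add_norm_sub' _ _
      _ ≤ ‖y 0‖ * Real.exp (|z.im| * s) + (‖y' 0‖ + M * ∫ t in (0 : ℝ)..1, ‖q t‖)
            * (Real.exp (|z.im| * s) / ‖z‖) := by
          rw [norm_mul]
          exact add_le_add (mul_le_mul_of_nonneg_left hcos (norm_nonneg _))
            (hy.norm_sub_cos_le hq (norm_pos_iff.1 hz0) hM hs)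
      _ = _ := by ring
  have hderiv : ‖y' 0‖ / ‖z‖ ≤ ‖y' 0‖ := div_le_self (norm_nonneg _) hz
  have hhalf : (M * ∫ t in (0 : ℝ)..1, ‖q t‖) / ‖z‖ ≤ M / 2 := by
    rw [div_le_div_iff₀ hz0 two_pos, mul_assoc, mul_comm (∫ t in (0 : ℝ)..1, ‖q t‖)]
    exact mul_le_mul_of_nonneg_left hzq (by positivity)
  rw [add_div] at hle
  refine (hM x hx).trans (mul_le_mul_of_nonneg_right ?_ (Real.exp_pos _).le)
  linarith

end IsSolution

variable (hq : IntervalIntegrable q volume 0 1)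

theorem isBigO_solution_sub_cos (a c : ℂ) :
    (fun p : ℂ × ℝ => solution hq a c (p.1 ^ 2) p.2 - a * Complex.cos (p.1 * p.2))
      =O[Bornology.cobounded ℂ ×ˢ 𝓟 (Icc 0 1)]
    fun p => Real.exp (|p.1.im| * p.2) / ‖p.1‖ := by
  have hlarge : ∀ᶠ z : ℂ in Bornology.cobounded ℂ,
      max 1 (2 * ∫ t in (0 : ℝ)..1, ‖q t‖) ≤ ‖z‖ :=
    tendsto_norm_cobounded_atTop.eventually_ge_atTop _
  refine IsBigO.of_bound (‖c‖ + 2 * (‖a‖ + ‖c‖) * ∫ t in (0 : ℝ)..1, ‖q t‖) ?_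
  filter_upwards [hlarge.prod_mk (eventually_mem_principal (Icc (0 : ℝ) 1))] with p hp
  have hsol := isSolution_solution hq a c (p.1 ^ 2)
  have hbound := hsol.norm_sub_cos_le hq
    (norm_pos_iff.1 (one_pos.trans_le ((le_max_left _ _).trans hp.1)))
    (fun t ht => hsol.norm_le hq ((le_max_left _ _).trans hp.1) ((le_max_right _ _).trans hp.1) ht)
    hp.2
  rw [solution_zero, solutionDeriv_zero] at hbound
  rwa [Real.norm_of_nonneg (by positivity)]

theorem tendsto_cobounded_prod_mk {x : ℝ} {s : Set ℝ} (hx : x ∈ s) :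
    Tendsto (fun z : ℂ => (z, x)) (Bornology.cobounded ℂ) (Bornology.cobounded ℂ ×ˢ 𝓟 s) :=
  tendsto_id.prodMk (tendsto_principal.2 (Eventually.of_forall fun _ => hx))

theorem isBigO_varphi {x : ℝ} (hx : x ∈ Icc (0 : ℝ) 1) :
    (fun z : ℂ => varphi hq (z ^ 2) x) =O[Bornology.cobounded ℂ]
      fun z => Real.exp (|z.im| * x) / ‖z‖ := by
  simpa [varphi, Function.comp_def] using
    (isBigO_solution_sub_cos hq 0 1).comp_tendsto (tendsto_cobounded_prod_mk hx)

theorem isBigO_psi_sub_cos (b : ℂ) {x : ℝ} (hx : x ∈ Icc (0 : ℝ) 1) :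
    (fun z : ℂ => psi hq b (z ^ 2) x - Complex.cos (z * (1 - x : ℝ))) =O[Bornology.cobounded ℂ]
      fun z => Real.exp (|z.im| * (1 - x)) / ‖z‖ := by
  have hx' : 1 - x ∈ Icc (0 : ℝ) 1 := ⟨sub_nonneg.2 hx.2, sub_le_self _ hx.1⟩
  simpa only [psi, Function.comp_def, one_mul] using
    (isBigO_solution_sub_cos (intervalIntegrable_reflect hq) 1 b).comp_tendsto
      (tendsto_cobounded_prod_mk hx')

theorem isBigO_psi (b : ℂ) {x : ℝ} (hx : x ∈ Icc (0 : ℝ) 1) :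
    (fun z : ℂ => psi hq b (z ^ 2) x) =O[Bornology.cobounded ℂ]
      fun z => Real.exp (|z.im| * (1 - x)) := by
  have hcos : (fun z : ℂ => Complex.cos (z * (1 - x : ℝ))) =O[Bornology.cobounded ℂ]
      fun z => Real.exp (|z.im| * (1 - x)) := IsBigO.of_norm_le fun z => by
    simpa only [abs_im_mul_ofReal z (sub_nonneg.2 hx.2)] using norm_cos_le (z * (1 - x : ℝ))
  have herror : (fun z : ℂ => Real.exp (|z.im| * (1 - x)) / ‖z‖) =O[Bornology.cobounded ℂ]
      fun z => Real.exp (|z.im| * (1 - x)) := by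
    refine IsBigO.of_bound 1 ?_
    filter_upwards [tendsto_norm_cobounded_atTop.eventually_ge_atTop 1] with z hz
    rw [norm_div, norm_norm, one_mul]
    exact div_le_self (norm_nonneg _) hz
  simpa using ((isBigO_psi_sub_cos hq b hx).trans herror).add hcos

theorem isBigO_charFun_sub_cos (b : ℂ) :
    (fun z : ℂ => charFun hq b (z ^ 2) - Complex.cos z) =O[Bornology.cobounded ℂ]
      fun z => Real.exp |z.im| / ‖z‖ := by
  simpa [charFun_eq_psi_zero] using isBigO_psi_sub_cos hq b (left_mem_Icc.2 zero_le_one)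

end Asymptotics

/-! ### Eigenvalues as zeros of the characteristic function -/

section Eigenvalue

theorem ae_unitMeasure_iff {P : ℝ → Prop} :
    (∀ᵐ x ∂unitMeasure, P x) ↔ ∀ᵐ x, x ∈ Ioo (0 : ℝ) 1 → P x :=
  ae_restrict_iff' measurableSet_Ioo

theorem memLp_unitMeasure_of_continuous {f : ℝ → ℝ} (hf : Continuous f) {p : ENNReal} :
    MemLp f p unitMeasure := by
  obtain ⟨C, hC⟩ := isCompact_Icc.exists_bound_of_continuousOn (s := Icc (0 : ℝ) 1) hf.continuousOn
  exact .of_bound hf.aestronglyMeasurable C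
    (ae_unitMeasure_iff.2 (Eventually.of_forall fun x hx => hC x (Ioo_subset_Icc_self hx)))

theorem IsRegular.isPrimitive {y : ℝ → ℝ} (hy : IsRegular y) : IsPrimitive y (D y) 0 1 := by
  have hcont : ContinuousOn (D y) (Icc 0 1) := by simpa using hy.absolutelyContinuous.continuousOn
  refine ⟨hcont.intervalIntegrable_of_Icc zero_le_one, fun x hx => ?_⟩
  rw [uIcc_of_le zero_le_one] at hx
  have hmono : Icc (0 : ℝ) x ⊆ Icc 0 1 := Icc_subset_Icc_right hx.2
  rw [intervalIntegral.integral_eq_sub_of_hasDerivAt_of_le hx.1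
    (hy.differentiableOn.continuousOn.mono hmono) (fun t ht => ?_)
    ((hcont.mono hmono).intervalIntegrable_of_Icc hx.1), add_sub_cancel]
  exact (hy.differentiableOn t (hmono (Ioo_subset_Icc_self ht))).hasDerivWithinAt.hasDerivAt
    (Icc_mem_nhds ht.1 (ht.2.trans_le hx.2))

theorem IsRegular.isSolution {q y : ℝ → ℝ} {r : ℝ} (hy : IsRegular y)
    (heq : expression q y =ᵐ[unitMeasure] fun x => r * y x) : IsSolution q r y (D y) where
  isPrimitive := hy.isPrimitive
  isPrimitive_deriv := by
    have hderiv : IsPrimitive (D y) (deriv (D y)) 0 1 :=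
      .of_absolutelyContinuousOnInterval hy.absolutelyContinuous
        hy.absolutelyContinuous.intervalIntegrable_deriv
        (hy.absolutelyContinuous.ae_differentiableAt.mono fun x hx hmem => (hx hmem).hasDerivAt)
    refine hderiv.congr (fun _ _ => rfl) ?_
    filter_upwards [ae_unitMeasure_iff.1 heq, Measure.ae_ne volume 0, Measure.ae_ne volume 1]
      with x hx hzero hone hmem
    rw [uIcc_of_le zero_le_one] at hmem
    have heqx := hx ⟨hmem.1.lt_of_ne hzero.symm, hmem.2.lt_of_ne hone⟩
    rw [expression] at heqx
    linear_combination -heqx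

namespace IsSolution

variable {q y y' : ℝ → ℝ} {r : ℝ}

theorem eqOn_D (hy : IsSolution q r y y') : EqOn (D y) y' (Icc 0 1) := fun x hx =>
  (hy.hasDerivWithinAt hx).derivWithin (uniqueDiffOn_Icc one_pos x hx)

theorem isRegular (hy : IsSolution q r y y') : IsRegular y where
  differentiableOn _ hx := (hy.hasDerivWithinAt hx).differentiableWithinAt
  absolutelyContinuous := absolutelyContinuousOnInterval_congr
    (by simpa using hy.eqOn_D.symm) hy.isPrimitive_deriv.absolutelyContinuousOnInterval

theorem expression_ae_eq (hy : IsSolution q r y y') :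
    expression q y =ᵐ[unitMeasure] fun x => r * y x := by
  have hD : IsPrimitive (D y) (fun x => (q x - r) * y x) 0 1 :=
    hy.isPrimitive_deriv.congr (by simpa using hy.eqOn_D.symm) (Eventually.of_forall fun _ _ => rfl)
  refine ae_unitMeasure_iff.2 ?_
  filter_upwards [hD.ae_hasDerivAt] with x hx hmem
  rw [expression, (hx (Icc_subset_uIcc (Ioo_subset_Icc_self hmem))).deriv]
  ring

end IsSolution

variable {q : ℝ → ℝ} (hq : IntervalIntegrable q volume 0 1)

theorem eqOn_mul_varphi {r : ℝ} {y y' : ℝ → ℝ} (hy : IsSolution q r y y') (hy0 : y 0 = 0) :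
    EqOn y (fun x => y' 0 * varphi hq r x) (Icc 0 1) := fun x hx => by
  have hmul := ((isSolution_varphi hq r).const_mul (y' 0)).eqOn_solution hq hx
  rw [varphi_zero, varphiDeriv_zero, mul_zero, mul_one] at hmul
  have hsol := hy.eqOn_solution hq hx
  rw [hy0] at hsol
  exact hsol.trans hmul.symm

theorem phi_one_eq_varphi (r : ℝ) : phi q r 1 = varphi hq r 1 := by
  have hsol := isSolution_varphi hq r
  have hex : ∃ y, IsPhi q r y := ⟨varphi hq r, hsol.isRegular, hsol.expression_ae_eq,
    varphi_zero hq r, by rw [hsol.eqOn_D (left_mem_Icc.2 zero_le_one), varphiDeriv_zero]⟩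
  have hphi : IsPhi q r (phi q r) := Classical.epsilon_spec hex
  have heq := eqOn_mul_varphi hq (hphi.regular.isSolution hphi.equation) hphi.value_zero
    (right_mem_Icc.2 zero_le_one)
  simpa [hphi.deriv_zero] using heq

theorem charFun_eq_zero_of_isEigenvalue {b r : ℝ} (hr : IsEigenvalue q b r) :
    charFun hq b r = 0 := by
  obtain ⟨y, hy, hne, heq⟩ := hr
  have hsol := hy.regular.isSolution heq
  have hmul := eqOn_mul_varphi hq hsol hy.left_bc
  have hmulDeriv := hsol.deriv_eqOn ((isSolution_varphi hq r).const_mul (D y 0)) hmul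
  have hderiv : D y 0 ≠ 0 := fun hzero => hne (ae_unitMeasure_iff.2
    (Eventually.of_forall fun x hx => by simp [hmul (Ioo_subset_Icc_self hx), hzero]))
  have hbc := hy.right_bc
  rw [hmul (right_mem_Icc.2 zero_le_one), hmulDeriv (right_mem_Icc.2 zero_le_one)] at hbc
  refine (mul_eq_zero.1 (?_ : D y 0 * charFun hq b r = 0)).resolve_left hderiv
  rw [charFun]
  linear_combination hbc

theorem isEigenvalue_of_charFun_eq_zero {b r : ℝ} (hr : charFun hq b r = 0) :
    IsEigenvalue q b r := by
  have hsol := isSolution_varphi hq r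
  refine ⟨varphi hq r, ⟨hsol.isRegular, ?_, varphi_zero hq r, ?_⟩, fun hzero => ?_,
    hsol.expression_ae_eq⟩
  · exact (memLp_congr_ae hsol.expression_ae_eq).2
      (memLp_unitMeasure_of_continuous ((continuous_varphi hq r).const_mul r))
  · rw [hsol.eqOn_D (right_mem_Icc.2 zero_le_one)]
    exact hr
  · have hIoo : EqOn (varphi hq r) 0 (Ioo 0 1) :=
      Measure.eqOn_open_of_ae_eq hzero isOpen_Ioo (continuous_varphi hq r).continuousOn
        continuousOn_const
    obtain ⟨x, hx, hne⟩ := exists_varphi_ne_zero hq r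
    have hIcc := hIoo.closure (continuous_varphi hq r) continuous_const
    rw [closure_Ioo zero_ne_one] at hIcc
    exact hne (hIcc hx)

theorem isEigenvalue_iff {b r : ℝ} : IsEigenvalue q b r ↔ charFun hq b r = 0 :=
  ⟨charFun_eq_zero_of_isEigenvalue hq, isEigenvalue_of_charFun_eq_zero hq⟩

end Eigenvalue

/-! ### Location and enumeration of the eigenvalues -/

section Location

open Asymptotics

theorem isLittleO_div_of_tendsto_atTop {α : Type*} {l : Filter α} {f k : α → ℝ}
    (hk : Tendsto k l atTop) : (fun x => f x / k x) =o[l] f := by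
  simpa [div_eq_mul_inv] using
    (isBigO_refl f l).mul_isLittleO ((isLittleO_one_iff ℝ).2 (tendsto_inv_atTop_zero.comp hk))

theorem isLittleO_charFun_sub_cos {q : ℝ → ℂ} (hq : IntervalIntegrable q volume 0 1) (b : ℂ) :
    (fun z : ℂ => charFun hq b (z ^ 2) - Complex.cos z) =o[Bornology.cobounded ℂ]
      fun z => Real.exp |z.im| :=
  (isBigO_charFun_sub_cos hq b).trans_isLittleO
    (isLittleO_div_of_tendsto_atTop tendsto_norm_cobounded_atTop)

theorem tendsto_sqrt_neg_mul_I :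
    Tendsto (fun r : ℝ => (√(-r) : ℂ) * Complex.I) atBot (Bornology.cobounded ℂ) := by
  rw [← tendsto_norm_atTop_iff_cobounded]
  simpa [abs_of_nonneg, Function.comp_def] using
    Real.tendsto_sqrt_atTop.comp (tendsto_neg_atBot_atTop (G := ℝ))

theorem sqrt_neg_mul_I_sq {r : ℝ} (hr : r ≤ 0) : ((√(-r) : ℂ) * Complex.I) ^ 2 = r := by
  rw [mul_pow, Complex.I_sq, ← Complex.ofReal_pow, Real.sq_sqrt (neg_nonneg.2 hr)]
  push_cast
  ring

variable {q : ℝ → ℝ} (hq : IntervalIntegrable q volume 0 1) (b : ℝ)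

theorem eventually_solution_pos :
    ∀ᶠ r in atBot, ∀ x ∈ Icc (0 : ℝ) 1, 0 < solution hq 1 b r x := by
  have hlittle := (isBigO_solution_sub_cos (intervalIntegrable_ofReal hq) (1 : ℝ) b).trans_isLittleO
    (isLittleO_div_of_tendsto_atTop (tendsto_norm_cobounded_atTop.comp tendsto_fst))
  have hbound := eventually_prod_principal_iff.1 (hlittle.bound (c := 1 / 4) (by norm_num))
  filter_upwards [tendsto_sqrt_neg_mul_I.eventually hbound, eventually_le_atBot 0]
    with r hr hr0 x hx
  have hnorm := hr x hx
  set τ := √(-r)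
  have hτ : 0 ≤ τ := Real.sqrt_nonneg _
  have hcos : Complex.cos (τ * Complex.I * x) = (Real.cosh (τ * x) : ℂ) := by
    rw [mul_right_comm, Complex.cos_mul_I]
    push_cast
    rfl
  have him : |((τ : ℂ) * Complex.I).im| = τ := by simp [abs_of_nonneg hτ]
  rw [sqrt_neg_mul_I_sq hr0, solution_ofReal hq 1 b r hx, hcos, him, ← Complex.ofReal_mul,
    ← Complex.ofReal_sub, Complex.norm_real, one_mul, Real.norm_eq_abs,
    Real.norm_of_nonneg (Real.exp_nonneg _)] at hnorm
  have hcosh : Real.exp (τ * x) / 2 ≤ Real.cosh (τ * x) := by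
    rw [Real.cosh_eq]
    linarith [Real.exp_pos (-(τ * x))]
  linarith [(abs_le.1 hnorm).1, Real.exp_pos (τ * x)]

theorem eventually_psi_pos : ∀ᶠ r in atBot, ∀ x ∈ Icc (0 : ℝ) 1, 0 < psi hq b r x :=
  (eventually_solution_pos (intervalIntegrable_reflect hq) b).mono fun _ hr x hx =>
    hr (1 - x) ⟨sub_nonneg.2 hx.2, sub_le_self _ hx.1⟩

theorem eventually_charFun_pos : ∀ᶠ r in atBot, 0 < charFun hq b r :=
  (eventually_psi_pos hq b).mono fun r hr =>
    charFun_eq_psi_zero hq b r ▸ hr 0 (left_mem_Icc.2 zero_le_one)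

theorem tendsto_natCast_mul_pi_atTop : Tendsto (fun k : ℕ => k * Real.pi) atTop atTop :=
  tendsto_natCast_atTop_atTop.atTop_mul_const Real.pi_pos

theorem eventually_neg_one_pow_mul_charFun_pos :
    ∀ᶠ k : ℕ in atTop, 0 < (-1) ^ k * charFun hq b ((k * Real.pi) ^ 2) := by
  have htendsto : Tendsto (fun k : ℕ => ((k * Real.pi : ℝ) : ℂ)) atTop (Bornology.cobounded ℂ) :=
    (RCLike.tendsto_ofReal_atTop_cobounded ℂ).comp tendsto_natCast_mul_pi_atTop
  filter_upwards [htendsto.eventually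
    ((isLittleO_charFun_sub_cos (intervalIntegrable_ofReal hq) b).bound one_half_pos)] with k hk
  rw [← Complex.ofReal_pow, charFun_ofReal hq, ← Complex.ofReal_cos, ← Complex.ofReal_sub,
    Complex.norm_real, Real.cos_nat_mul_pi, Complex.ofReal_im, abs_zero, Real.exp_zero, norm_one,
    mul_one, Real.norm_eq_abs] at hk
  obtain ⟨hlower, hupper⟩ := abs_le.1 hk
  rcases neg_one_pow_eq_or ℝ k with hsign | hsign <;> rw [hsign] at hlower hupper ⊢ <;> linarith

theorem infinite_zeros_charFun : {r | charFun hq b r = 0}.Infinite := by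
  refine infinite_of_not_bddAbove fun ⟨R, hR⟩ => ?_
  have hsign := eventually_neg_one_pow_mul_charFun_pos hq b
  have hlarge : ∀ᶠ k : ℕ in atTop, R < (k * Real.pi) ^ 2 :=
    ((tendsto_pow_atTop two_ne_zero).comp tendsto_natCast_mul_pi_atTop).eventually_gt_atTop R
  obtain ⟨k, ⟨hk, hRk⟩, hk_succ⟩ :=
    ((hsign.and hlarge).and ((tendsto_add_atTop_nat 1).eventually hsign)).exists
  have hle : (k * Real.pi) ^ 2 ≤ ((k + 1 : ℕ) * Real.pi) ^ 2 := by
    gcongr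
    exact Nat.le_succ k
  have hcont : ContinuousOn (fun r => (-1) ^ k * charFun hq b r)
      (Icc ((k * Real.pi) ^ 2) (((k + 1 : ℕ) * Real.pi) ^ 2)) :=
    ((differentiable_charFun hq b).continuous.const_mul _).continuousOn
  have hneg : (-1) ^ k * charFun hq b (((k + 1 : ℕ) * Real.pi) ^ 2) ≤ 0 := by
    rw [pow_succ] at hk_succ
    linarith
  obtain ⟨r, hr, hzero⟩ := intermediate_value_Icc' hle hcont ⟨hneg, hk.le⟩
  exact (hRk.trans_le hr.1).not_ge (hR ((mul_eq_zero.1 hzero).resolve_left (by simp)))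

theorem finite_zeros_inter_of_isCompact {𝕜 : Type*} [NontriviallyNormedField 𝕜] {w : 𝕜 → 𝕜}
    (hw : Differentiable 𝕜 w) (hderiv : ∀ c, w c = 0 → deriv w c ≠ 0) {K : Set 𝕜}
    (hK : IsCompact K) : ({c | w c = 0} ∩ K).Finite := by
  by_contra hinf
  obtain ⟨c, -, hacc⟩ := Set.Infinite.exists_accPt_of_subset_isCompact hinf hK inter_subset_right
  have hfreq : ∃ᶠ m in 𝓝[≠] c, w m = 0 := (accPt_iff_frequently_nhdsNE.1 hacc).mono fun _ hm => hm.1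
  have hzero : w c = 0 := by_contra fun hne =>
    hfreq ((hw.continuous.continuousAt.eventually_ne hne).filter_mono nhdsWithin_le_nhds)
  exact hfreq ((hw c).hasDerivAt.eventually_ne (hderiv c hzero))

theorem finite_zeros_charFun_inter_Iic (t : ℝ) : ({r | charFun hq b r = 0} ∩ Iic t).Finite := by
  obtain ⟨T, hT⟩ := eventually_atBot.1 (eventually_charFun_pos hq b)
  refine (finite_zeros_inter_of_isCompact (differentiable_charFun hq b)
    (fun _ => deriv_charFun_ne_zero hq) (isCompact_Icc (a := T) (b := t))).subset ?_
  exact fun r hr => ⟨hr.1, le_of_not_ge fun hle => (hT r hle).ne' hr.1, hr.2⟩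

end Location

section Enumeration

variable {α : Type*} [LinearOrder α] {Z : Set α}

theorem encard_inter_Iic_of_mem {r : α} (hr : r ∈ Z) :
    (Z ∩ Iic r).encard = (Z ∩ Iio r).encard + 1 := by
  rw [← Iio_insert, inter_insert_of_mem hr, encard_insert_of_notMem (by simp)]

theorem isLeast_encard_inter_Iic {r : α} (hr : r ∈ Z) (hfin : (Z ∩ Iio r).Finite) :
    IsLeast {t | ((Z ∩ Iio r).ncard + 1 : ℕ∞) ≤ (Z ∩ Iic t).encard} r := by
  simp only [hfin.cast_ncard_eq]
  refine ⟨(encard_inter_Iic_of_mem hr).ge, fun t ht => le_of_not_gt fun hlt => ?_⟩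
  have hle : (Z ∩ Iic t).encard ≤ (Z ∩ Iio r).encard :=
    encard_le_encard (inter_subset_inter_right _ (Iic_subset_Iio.2 hlt))
  exact (ENat.add_one_le_iff hfin.encard_lt_top.ne).1 (ht.trans hle) |>.false

theorem exists_mem_inter_Iic_eq {t : α} (hfin : (Z ∩ Iic t).Finite) (hne : (Z ∩ Iic t).Nonempty) :
    ∃ m ∈ Z, m ≤ t ∧ Z ∩ Iic m = Z ∩ Iic t := by
  obtain ⟨m, hm, hmax⟩ := exists_max_image _ id hfin hne
  exact ⟨m, hm.1, hm.2, Subset.antisymm (inter_subset_inter_right _ (Iic_subset_Iic.2 hm.2))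
    fun r hr => ⟨hr.1, hmax r hr⟩⟩

theorem exists_isLeast_encard_inter_Iic (hinf : Z.Infinite) (hfin : ∀ t, (Z ∩ Iic t).Finite)
    (n : ℕ) : ∃ m ∈ Z, IsLeast {t | (n + 1 : ℕ∞) ≤ (Z ∩ Iic t).encard} m := by
  set S := {t | (n + 1 : ℕ∞) ≤ (Z ∩ Iic t).encard}
  have hmax : ∀ t ∈ S, ∃ m ∈ Z, m ≤ t ∧ m ∈ S := fun t ht => by
    obtain ⟨m, hmZ, hmt, hm⟩ := exists_mem_inter_Iic_eq (hfin t)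
      (encard_pos.1 ((by simp : (0 : ℕ∞) < n + 1).trans_le ht))
    exact ⟨m, hmZ, hmt, (hm ▸ ht : (n + 1 : ℕ∞) ≤ (Z ∩ Iic m).encard)⟩
  have hne : (Z ∩ S).Nonempty := by
    obtain ⟨F, hFZ, hFfin, hF⟩ := hinf.exists_subset_ncard_eq (n + 1)
    have : Nonempty α := hinf.nonempty.to_type
    obtain ⟨t, ht⟩ := hFfin.bddAbove
    obtain ⟨m, hmZ, -, hmS⟩ := hmax t (by
      refine le_trans ?_ (encard_le_encard (subset_inter hFZ fun _ hr => ht hr))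
      rw [← hFfin.cast_ncard_eq, hF]
      simp)
    exact ⟨m, hmZ, hmS⟩
  obtain ⟨m₀, hm₀⟩ := hne
  obtain ⟨m, ⟨⟨hmZ, hmm₀⟩, hmS⟩, hmin⟩ := exists_min_image _ id ((hfin m₀).inter_of_left S)
    ⟨m₀, ⟨hm₀.1, le_rfl⟩, hm₀.2⟩
  refine ⟨m, hmZ, hmS, fun t ht => ?_⟩
  obtain ⟨m', hmZ', hmt', hmS'⟩ := hmax t ht
  rcases le_total m' m₀ with hle | hle
  · exact (hmin m' ⟨⟨hmZ', hle⟩, hmS'⟩).trans hmt'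
  · exact (hmm₀.trans hle).trans hmt'

end Enumeration

theorem range_sInf_encard_inter_Iic {α : Type*} [ConditionallyCompleteLinearOrder α] {Z : Set α}
    (hinf : Z.Infinite) (hfin : ∀ t, (Z ∩ Iic t).Finite) :
    range (fun n : ℕ => sInf {t | (n + 1 : ℕ∞) ≤ (Z ∩ Iic t).encard}) = Z := by
  refine Subset.antisymm (range_subset_iff.2 fun n => ?_) fun r hr => ?_
  · obtain ⟨m, hm, hleast⟩ := exists_isLeast_encard_inter_Iic hinf hfin n
    rwa [hleast.csInf_eq]
  · have hfin' := (hfin r).subset (inter_subset_inter_right Z Iio_subset_Iic_self)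
    exact ⟨(Z ∩ Iio r).ncard, (isLeast_encard_inter_Iic hr hfin').csInf_eq⟩

theorem range_eigenvalue {q : ℝ → ℝ} (hq : IntervalIntegrable q volume 0 1) (b : ℝ) :
    range (eigenvalue q b) = {r | charFun hq b r = 0} := by
  rw [← range_sInf_encard_inter_Iic (infinite_zeros_charFun hq b)
    (finite_zeros_charFun_inter_Iic hq b)]
  congr! with n
  simp only [eigenvalue, isEigenvalue_iff hq]
  rfl

/-! ### Quotients by functions with simple zeros -/

section Quotient

variable {𝕜 : Type*} [RCLike 𝕜] {g w : 𝕜 → 𝕜} {c : 𝕜}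

open Classical in
/-- The quotient `g / w`, with the value given by l'Hôpital's rule at the zeros of `w`. It extends
`g / w` continuously when these zeros are simple and `g` vanishes there. -/
noncomputable def simpleQuotient (g w : 𝕜 → 𝕜) (c : 𝕜) : 𝕜 :=
  if w c = 0 then deriv g c / deriv w c else g c / w c

theorem simpleQuotient_of_eq_zero (hc : w c = 0) :
    simpleQuotient g w c = deriv g c / deriv w c := if_pos hc

theorem simpleQuotient_of_ne_zero (hc : w c ≠ 0) : simpleQuotient g w c = g c / w c := if_neg hc

theorem simpleQuotient_mul (hgc : w c = 0 → g c = 0) : simpleQuotient g w c * w c = g c := by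
  by_cases hc : w c = 0
  · rw [hc, mul_zero, hgc hc]
  · rw [simpleQuotient_of_ne_zero hc, div_mul_cancel₀ _ hc]

theorem simpleQuotient_ne_zero (hgw : w c = 0 ↔ g c = 0) (hdw : w c = 0 → deriv w c ≠ 0)
    (hdg : g c = 0 → deriv g c ≠ 0) : simpleQuotient g w c ≠ 0 := by
  by_cases hc : w c = 0
  · rw [simpleQuotient_of_eq_zero hc]
    exact div_ne_zero (hdg (hgw.1 hc)) (hdw hc)
  · rw [simpleQuotient_of_ne_zero hc]
    exact div_ne_zero (mt hgw.2 hc) hc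

theorem simpleQuotient_eventuallyEq_div (hw : Continuous w) (hc : w c ≠ 0) :
    simpleQuotient g w =ᶠ[𝓝 c] fun m => g m / w m :=
  (hw.continuousAt.eventually_ne hc).mono fun _ => simpleQuotient_of_ne_zero

theorem simpleQuotient_eventuallyEq_dslope (hw : DifferentiableAt 𝕜 w c) (hc : w c = 0)
    (hgc : g c = 0) (hd : deriv w c ≠ 0) :
    simpleQuotient g w =ᶠ[𝓝 c] fun m => dslope g c m / dslope w c m := by
  have hfactor : ∀ {f : 𝕜 → 𝕜}, f c = 0 → ∀ m, f m = (m - c) * dslope f c m := fun {f} hf m => by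
    rw [← smul_eq_mul, sub_smul_dslope, hf, sub_zero]
  filter_upwards [(continuousAt_dslope_same.2 hw).eventually_ne (by rwa [dslope_same])] with m hm
  rcases eq_or_ne m c with rfl | hmc
  · rw [simpleQuotient_of_eq_zero hc, dslope_same, dslope_same]
  · have hwm : w m ≠ 0 := hfactor hc m ▸ mul_ne_zero (sub_ne_zero.2 hmc) hm
    rw [simpleQuotient_of_ne_zero hwm, hfactor hgc m, hfactor hc m,
      mul_div_mul_left _ _ (sub_ne_zero.2 hmc)]

theorem continuous_simpleQuotient (hg : Differentiable 𝕜 g) (hw : Differentiable 𝕜 w)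
    (hgw : ∀ c, w c = 0 → g c = 0) (hd : ∀ c, w c = 0 → deriv w c ≠ 0) :
    Continuous (simpleQuotient g w) := by
  refine continuous_iff_continuousAt.2 fun c => ?_
  by_cases hc : w c = 0
  · refine .congr ?_ (simpleQuotient_eventuallyEq_dslope (hw c) hc (hgw c hc) (hd c hc)).symm
    exact (continuousAt_dslope_same.2 (hg c)).div (continuousAt_dslope_same.2 (hw c))
      (by rw [dslope_same]; exact hd c hc)
  · exact (hg.continuous.continuousAt.div hw.continuous.continuousAt hc).congr
      (simpleQuotient_eventuallyEq_div hw.continuous hc).symm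

theorem differentiable_simpleQuotient {g w : ℂ → ℂ} (hg : Differentiable ℂ g)
    (hw : Differentiable ℂ w) (hgw : ∀ c, w c = 0 → g c = 0)
    (hd : ∀ c, w c = 0 → deriv w c ≠ 0) : Differentiable ℂ (simpleQuotient g w) := fun c => by
  by_cases hc : w c = 0
  · have hdslope : ∀ {f : ℂ → ℂ}, Differentiable ℂ f → DifferentiableAt ℂ (dslope f c) c :=
      fun hf => ((Complex.differentiableOn_dslope univ_mem).2
        hf.differentiableOn).differentiableAt univ_mem
    exact ((hdslope hg).div (hdslope hw) (by rw [dslope_same]; exact hd c hc)).congr_of_eventuallyEq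
      (simpleQuotient_eventuallyEq_dslope (hw c) hc (hgw c hc) (hd c hc))
  · exact ((hg c).div (hw c) hc).congr_of_eventuallyEq
      (simpleQuotient_eventuallyEq_div hw.continuous hc)

theorem deriv_mul_deriv_pos {g w : ℝ → ℝ} (hg : Differentiable ℝ g) (hw : Differentiable ℝ w)
    (hgw : ∀ c, w c = 0 ↔ g c = 0) (hdw : ∀ c, w c = 0 → deriv w c ≠ 0)
    (hdg : ∀ c, g c = 0 → deriv g c ≠ 0) {a : ℝ} (hga : 0 < g a) (hwa : 0 < w a) {r : ℝ}
    (hr : w r = 0) : 0 < deriv g r * deriv w r := by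
  have hcont := continuous_simpleQuotient hg hw (fun c => (hgw c).1) hdw
  have ha : 0 < simpleQuotient g w a := by
    rw [simpleQuotient_of_ne_zero hwa.ne']
    exact div_pos hga hwa
  -- `g / w` extends continuously to a function without zeros, so its sign is constant.
  have hpos : 0 < simpleQuotient g w r := by
    by_contra! hle
    obtain ⟨c, hc⟩ := mem_range_of_exists_le_of_exists_ge hcont ⟨r, hle⟩ ⟨a, ha.le⟩
    exact simpleQuotient_ne_zero (hgw c) (hdw c) (hdg c) hc
  rw [simpleQuotient_of_eq_zero hr] at hpos
  exact mul_pos_iff.2 (div_pos_iff.1 hpos)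

end Quotient

/-! ### A vanishing criterion for entire functions -/

section Vanishing

open Asymptotics Bornology

theorem norm_cos_sq (z : ℂ) : ‖Complex.cos z‖ ^ 2 = Real.sinh z.im ^ 2 + Real.cos z.re ^ 2 := by
  have hcos : Complex.cos z = ((Real.cos z.re * Real.cosh z.im : ℝ) : ℂ)
      + ((-(Real.sin z.re * Real.sinh z.im) : ℝ) : ℂ) * Complex.I := by
    rw [Complex.cos_eq z]
    push_cast
    ring
  rw [hcos, Complex.sq_norm, Complex.normSq_add_mul_I]
  linear_combination Real.cos z.re ^ 2 * Real.cosh_sq z.im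
    + Real.sinh z.im ^ 2 * Real.sin_sq_add_cos_sq z.re

theorem exp_abs_im_le_norm_cos_of_cos_sq_eq_one {z : ℂ} (hz : Real.cos z.re ^ 2 = 1) :
    Real.exp |z.im| / 4 ≤ ‖Complex.cos z‖ := by
  refine le_of_sq_le_sq ?_ (norm_nonneg _)
  rw [norm_cos_sq, hz, ← Real.cosh_sq, ← Real.cosh_abs]
  gcongr
  rw [Real.cosh_eq]
  linarith [Real.exp_pos |z.im|, Real.exp_pos (-|z.im|)]

theorem exp_abs_im_le_norm_cos_of_one_le {z : ℂ} (hz : 1 ≤ |z.im|) :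
    Real.exp |z.im| / 4 ≤ ‖Complex.cos z‖ := by
  have hsinh : Real.exp |z.im| / 4 ≤ Real.sinh |z.im| := by
    rw [Real.sinh_eq]
    linarith [Real.add_one_le_exp |z.im|, Real.exp_le_one_iff.2 (neg_nonpos.2 (abs_nonneg z.im))]
  refine le_of_sq_le_sq ?_ (norm_nonneg _)
  rw [norm_cos_sq, ← sq_abs (Real.sinh _), Real.abs_sinh]
  nlinarith [sq_nonneg (Real.cos z.re), Real.exp_pos |z.im|]

/-- The open square of side `2 a` centred at the origin. -/
def square (a : ℝ) : Set ℂ := Ioo (-a) a ×ℂ Ioo (-a) a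

theorem mem_square {a : ℝ} {z : ℂ} : z ∈ square a ↔ |z.re| < a ∧ |z.im| < a := by
  rw [square, Complex.mem_reProdIm, mem_Ioo, mem_Ioo, abs_lt, abs_lt]

theorem abs_eq_of_mem_frontier_square {a : ℝ} (ha : 0 < a) {z : ℂ} (hz : z ∈ frontier (square a)) :
    |z.re| = a ∨ |z.im| = a := by
  have hlt : -a < a := neg_lt_self ha
  have habs : ∀ {t : ℝ}, t ∈ ({-a, a} : Set ℝ) → |t| = a := fun ht => by
    rwa [abs_eq ha.le, or_comm]
  rw [square, Complex.frontier_reProdIm, closure_Ioo hlt.ne, frontier_Ioo hlt] at hz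
  exact hz.elim (fun h => .inr (habs h.2)) fun h => .inl (habs h.1)

theorem le_norm_of_mem_frontier_square {a : ℝ} (ha : 0 < a) {z : ℂ}
    (hz : z ∈ frontier (square a)) : a ≤ ‖z‖ :=
  (abs_eq_of_mem_frontier_square ha hz).elim (fun h => h ▸ Complex.abs_re_le_norm z)
    fun h => h ▸ Complex.abs_im_le_norm z

theorem exp_abs_im_le_norm_cos_of_mem_frontier_square {k : ℕ} (hk : k ≠ 0) {z : ℂ}
    (hz : z ∈ frontier (square (k * Real.pi))) : Real.exp |z.im| / 4 ≤ ‖Complex.cos z‖ := by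
  have hone : (1 : ℝ) ≤ k := Nat.one_le_cast.2 (Nat.one_le_iff_ne_zero.2 hk)
  rcases abs_eq_of_mem_frontier_square (mul_pos (one_pos.trans_le hone) Real.pi_pos) hz with h | h
  · refine exp_abs_im_le_norm_cos_of_cos_sq_eq_one ?_
    rw [← Real.cos_abs, h, Real.cos_nat_mul_pi, ← pow_mul, mul_comm, pow_mul, neg_one_sq, one_pow]
  · refine exp_abs_im_le_norm_cos_of_one_le ?_
    rw [h]
    nlinarith [Real.pi_gt_three]

theorem eventually_forall_mem_frontier_square {P : ℂ → Prop} (hP : ∀ᶠ z in cobounded ℂ, P z) :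
    ∀ᶠ a : ℝ in atTop, ∀ z ∈ frontier (square a), P z := by
  obtain ⟨R, -, hR⟩ := hasBasis_cobounded_norm.eventually_iff.1 hP
  filter_upwards [eventually_ge_atTop R, eventually_gt_atTop 0] with a haR ha z hz
  exact hR (haR.trans (le_norm_of_mem_frontier_square ha hz))

theorem eq_zero_of_eventually_norm_le_frontier_square {E ι : Type*} [NormedAddCommGroup E]
    [NormedSpace ℂ E] {f : ℂ → E} (hf : Differentiable ℂ f) {l : Filter ι} [l.NeBot] {a : ι → ℝ}
    (ha : Tendsto a l atTop)
    (hbound : ∀ ε > 0, ∀ᶠ i in l, ∀ z ∈ frontier (square (a i)), ‖f z‖ ≤ ε) : f = 0 := by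
  funext z
  refine norm_le_zero_iff.1 (le_of_forall_pos_le_add fun ε hε => ?_)
  obtain ⟨i, hi, hlt⟩ := ((hbound ε hε).and (ha.eventually_gt_atTop ‖z‖)).exists
  rw [zero_add]
  refine Complex.norm_le_of_forall_mem_frontier_norm_le (U := square (a i))
    ((Metric.isBounded_Ioo _ _).reProdIm (Metric.isBounded_Ioo _ _)) hf.diffContOnCl hi ?_
  exact subset_closure (mem_square.2 ⟨(Complex.abs_re_le_norm z).trans_lt hlt,
    (Complex.abs_im_le_norm z).trans_lt hlt⟩)

variable {g w : ℂ → ℂ}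

theorem eventually_norm_simpleQuotient_le (hgw : ∀ c, w c = 0 → g c = 0)
    (hg : (fun z => g (z ^ 2)) =o[cobounded ℂ] fun z => Real.exp |z.im|)
    (hw : (fun z => w (z ^ 2) - Complex.cos z) =o[cobounded ℂ] fun z => Real.exp |z.im|)
    {ε : ℝ} (hε : 0 < ε) :
    ∀ᶠ z in cobounded ℂ, Real.exp |z.im| / 4 ≤ ‖Complex.cos z‖ →
      ‖simpleQuotient g w (z ^ 2)‖ ≤ ε := by
  filter_upwards [hg.bound (c := ε / 8) (by positivity), hw.bound (c := 1 / 8) (by norm_num)]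
    with z hgz hwz hcos
  rw [Real.norm_of_nonneg (Real.exp_nonneg _)] at hgz hwz
  have hlower : Real.exp |z.im| / 8 ≤ ‖w (z ^ 2)‖ := by
    have htriangle := norm_sub_norm_le (Complex.cos z) (w (z ^ 2))
    rw [norm_sub_rev] at htriangle
    linarith
  refine le_of_mul_le_mul_right ?_ (div_pos (Real.exp_pos |z.im|) (by norm_num : (0 : ℝ) < 8))
  calc ‖simpleQuotient g w (z ^ 2)‖ * (Real.exp |z.im| / 8)
      ≤ ‖simpleQuotient g w (z ^ 2)‖ * ‖w (z ^ 2)‖ := by gcongr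
    _ = ‖g (z ^ 2)‖ := by rw [← norm_mul, simpleQuotient_mul (hgw _)]
    _ ≤ ε * (Real.exp |z.im| / 8) := by linarith

theorem eq_zero_of_isLittleO_exp_abs_im (hg : Differentiable ℂ g) (hw : Differentiable ℂ w)
    (hgw : ∀ c, w c = 0 → g c = 0) (hd : ∀ c, w c = 0 → deriv w c ≠ 0)
    (hgo : (fun z => g (z ^ 2)) =o[cobounded ℂ] fun z => Real.exp |z.im|)
    (hwo : (fun z => w (z ^ 2) - Complex.cos z) =o[cobounded ℂ] fun z => Real.exp |z.im|) :
    g = 0 := by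
  have hquotient : (fun z : ℂ => simpleQuotient g w (z ^ 2)) = 0 := by
    refine eq_zero_of_eventually_norm_le_frontier_square
      ((differentiable_simpleQuotient hg hw hgw hd).comp (differentiable_id.pow 2))
      tendsto_natCast_mul_pi_atTop fun ε hε => ?_
    filter_upwards [eventually_ne_atTop 0, tendsto_natCast_mul_pi_atTop.eventually
      (eventually_forall_mem_frontier_square (eventually_norm_simpleQuotient_le hgw hgo hwo hε))]
      with k hk hbound z hz
    exact hbound z hz (exp_abs_im_le_norm_cos_of_mem_frontier_square hk hz)
  funext c
  obtain ⟨z, rfl⟩ := IsAlgClosed.exists_pow_nat_eq c two_pos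
  rw [← simpleQuotient_mul (hgw (z ^ 2)), congrFun hquotient z, Pi.zero_apply, zero_mul,
    Pi.zero_apply]

end Vanishing

/-! ### Uniqueness -/

section Uniqueness

open Asymptotics Bornology

section Identity

variable {𝕜 : Type*} [RCLike 𝕜] {q p : ℝ → 𝕜}

theorem IsSolution.ae_eq_of_eqOn {l : 𝕜} {y y' u u' : ℝ → 𝕜} (hy : IsSolution q l y y')
    (hu : IsSolution p l u u') (hyu : EqOn y u (Icc 0 1)) (hne : ∀ x ∈ Icc (0 : ℝ) 1, y x ≠ 0) :
    ∀ᵐ x, x ∈ Icc (0 : ℝ) 1 → q x = p x := by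
  have hderiv := hy.isPrimitive_deriv.congr (by simpa using hy.deriv_eqOn hu hyu)
    (Eventually.of_forall fun _ _ => rfl)
  filter_upwards [hderiv.ae_hasDerivAt, hu.isPrimitive_deriv.ae_hasDerivAt] with x hyx hux hx
  have hx' : x ∈ uIcc (0 : ℝ) 1 := Icc_subset_uIcc hx
  have heq := (hyx hx').unique (hux hx')
  rw [← hyu hx] at heq
  exact sub_left_injective (mul_right_cancel₀ (hne x hx) heq)

variable (hq : IntervalIntegrable q volume 0 1) (hp : IntervalIntegrable p volume 0 1)

theorem charFun_mul_psi_sq_eq {b h l : 𝕜}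
    (heq : EqOn (fun x => varphi hq l x * psi hp h l x) (fun x => varphi hp l x * psi hq b l x)
      (Icc 0 1)) {x : ℝ} (hx : x ∈ Icc (0 : ℝ) 1) :
    charFun hq b l * psi hp h l x ^ 2 = charFun hp h l * psi hq b l x ^ 2 := by
  have hleft := ((isSolution_varphi hq l).hasDerivWithinAt hx).mul
    ((isSolution_psi hp h l).hasDerivWithinAt hx)
  have hright := ((isSolution_varphi hp l).hasDerivWithinAt hx).mul
    ((isSolution_psi hq b l).hasDerivWithinAt hx)
  have hderiv := (uniqueDiffOn_Icc one_pos x hx).eq_deriv _ hleft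
    (hright.congr heq (heq hx))
  have hvalue := heq hx
  dsimp only at hvalue
  rw [← wronskian_varphi_psi hq b l hx, ← wronskian_varphi_psi hp h l hx]
  linear_combination psi hp h l x * psi hq b l x * hderiv
    - (psi hq b l x * psiDeriv hp h l x + psi hp h l x * psiDeriv hq b l x) * hvalue

theorem charFun_eq_of_eqOn {b h l : 𝕜}
    (heq : EqOn (fun x => varphi hq l x * psi hp h l x) (fun x => varphi hp l x * psi hq b l x)
      (Icc 0 1)) : charFun hq b l = charFun hp h l := by
  simpa [psi_one] using charFun_mul_psi_sq_eq hq hp heq (right_mem_Icc.2 zero_le_one)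

end Identity

section Complex

variable {q p : ℝ → ℂ} (hq : IntervalIntegrable q volume 0 1)
  (hp : IntervalIntegrable p volume 0 1) {b h : ℂ}

theorem isLittleO_varphi_mul_psi (h : ℂ) {x : ℝ} (hx : x ∈ Icc (0 : ℝ) 1) :
    (fun z : ℂ => varphi hq (z ^ 2) x * psi hp h (z ^ 2) x) =o[cobounded ℂ]
      fun z => Real.exp |z.im| := by
  have hprod := (isBigO_varphi hq hx).mul (isBigO_psi hp h hx)
  have hexp : ∀ z : ℂ, Real.exp (|z.im| * x) / ‖z‖ * Real.exp (|z.im| * (1 - x))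
      = Real.exp |z.im| / ‖z‖ := fun z => by
    rw [div_mul_eq_mul_div, ← Real.exp_add]
    ring_nf
  simp only [hexp] at hprod
  exact hprod.trans_isLittleO (isLittleO_div_of_tendsto_atTop tendsto_norm_cobounded_atTop)

theorem varphi_mul_psi_eq (hzero : ∀ l, charFun hq b l = 0 → charFun hp h l = 0)
    (hsimple : ∀ l, charFun hq b l = 0 → deriv (charFun hq b) l ≠ 0)
    (hval : ∀ l, charFun hq b l = 0 → varphi hq l 1 = varphi hp l 1) (l : ℂ) {x : ℝ}
    (hx : x ∈ Icc (0 : ℝ) 1) :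
    varphi hq l x * psi hp h l x = varphi hp l x * psi hq b l x := by
  refine sub_eq_zero.1 (congrFun (eq_zero_of_isLittleO_exp_abs_im
    (g := fun l => varphi hq l x * psi hp h l x - varphi hp l x * psi hq b l x)
    (((differentiable_varphi hq x).mul (differentiable_psi hp h x)).sub
      ((differentiable_varphi hp x).mul (differentiable_psi hq b x)))
    (differentiable_charFun hq b) (fun c hc => ?_) hsimple
    ((isLittleO_varphi_mul_psi hq hp h hx).sub (isLittleO_varphi_mul_psi hp hq b hx))
    (isLittleO_charFun_sub_cos hq b)) l)
  rw [eqOn_varphi_mul_psi hq hc hx, eqOn_varphi_mul_psi hp (hzero c hc) hx, hval c hc]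
  ring

end Complex

variable {q p : ℝ → ℝ} (hq : IntervalIntegrable q volume 0 1)
  (hp : IntervalIntegrable p volume 0 1) {b h : ℝ}

theorem varphi_one_mul_pos (hzero : ∀ r, charFun hq b r = 0 ↔ charFun hp h r = 0) {r : ℝ}
    (hr : charFun hq b r = 0) : 0 < varphi hq r 1 * varphi hp r 1 := by
  obtain ⟨a, hqa, hpa⟩ := ((eventually_charFun_pos hq b).and (eventually_charFun_pos hp h)).exists
  have hderiv := deriv_mul_deriv_pos (differentiable_charFun hp h) (differentiable_charFun hq b)
    hzero (fun _ => deriv_charFun_ne_zero hq) (fun _ => deriv_charFun_ne_zero hp) hpa hqa hr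
  refine pos_of_mul_pos_left ?_ hderiv.le
  linarith [mul_pos_of_neg_of_neg (varphi_mul_deriv_charFun_neg hq hr)
    (varphi_mul_deriv_charFun_neg hp ((hzero r).1 hr))]

theorem exists_ofReal_of_charFun_eq_zero {l : ℂ}
    (hl : charFun (intervalIntegrable_ofReal hq) (b : ℂ) l = 0) :
    ∃ r : ℝ, (r : ℂ) = l ∧ charFun hq b r = 0 := by
  have hre : (l.re : ℂ) = l := Complex.ext rfl (im_eq_zero_of_charFun_eq_zero hq hl).symm
  rw [← hre, charFun_ofReal hq] at hl
  exact ⟨l.re, hre, Complex.ofReal_eq_zero.1 hl⟩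

theorem varphi_mul_psi_eq_of_real (hzero : ∀ r, charFun hq b r = 0 → charFun hp h r = 0)
    (hval : ∀ r, charFun hq b r = 0 → varphi hq r 1 = varphi hp r 1) (r : ℝ) {x : ℝ}
    (hx : x ∈ Icc (0 : ℝ) 1) :
    varphi hq r x * psi hp h r x = varphi hp r x * psi hq b r x := by
  have hone : (1 : ℝ) ∈ Icc 0 1 := right_mem_Icc.2 zero_le_one
  have hcomplex := varphi_mul_psi_eq (intervalIntegrable_ofReal hq) (intervalIntegrable_ofReal hp)
    (b := b) (h := h) (fun l hl => ?_) (fun l hl => ?_) (fun l hl => ?_) r hx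
  · rw [varphi_ofReal hq r hx, varphi_ofReal hp r hx, psi_ofReal hq b r hx,
      psi_ofReal hp h r hx] at hcomplex
    exact_mod_cast hcomplex
  all_goals obtain ⟨s, rfl, hs⟩ := exists_ofReal_of_charFun_eq_zero hq hl
  · rw [charFun_ofReal hp, hzero s hs, Complex.ofReal_zero]
  · exact deriv_charFun_ofReal_ne_zero hq hs
  · rw [varphi_ofReal hq s hone, varphi_ofReal hp s hone, hval s hs]

theorem ae_eq_and_eq_of_charFun (hzero : ∀ r, charFun hq b r = 0 ↔ charFun hp h r = 0)
    (habs : ∀ r, charFun hq b r = 0 → |varphi hq r 1| = |varphi hp r 1|) :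
    q =ᵐ[unitMeasure] p ∧ b = h := by
  have hval : ∀ r, charFun hq b r = 0 → varphi hq r 1 = varphi hp r 1 := fun r hr => by
    have hpos := varphi_one_mul_pos hq hp hzero hr
    refine (abs_eq_abs.1 (habs r hr)).resolve_right fun hneg => ?_
    rw [hneg, neg_mul] at hpos
    linarith [mul_self_nonneg (varphi hp r 1)]
  obtain ⟨r, hqpos, hppos⟩ := ((eventually_psi_pos hq b).and (eventually_psi_pos hp h)).exists
  have hG : EqOn (fun x => varphi hq r x * psi hp h r x) (fun x => varphi hp r x * psi hq b r x)
      (Icc 0 1) := fun x hx => varphi_mul_psi_eq_of_real hq hp (fun r => (hzero r).1) hval r hx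
  have hcharFun := charFun_eq_of_eqOn hq hp hG
  have hne : charFun hq b r ≠ 0 := by
    rw [charFun_eq_psi_zero]
    exact (hqpos 0 (left_mem_Icc.2 zero_le_one)).ne'
  have hpsi : EqOn (psi hq b r) (psi hp h r) (Icc 0 1) := fun x hx => by
    have hsq := charFun_mul_psi_sq_eq hq hp hG hx
    rw [← hcharFun] at hsq
    exact ((sq_eq_sq₀ (hppos x hx).le (hqpos x hx).le).1 (mul_left_cancel₀ hne hsq)).symm
  have hqsol := isSolution_psi hq b r
  have hpsol := isSolution_psi hp h r
  refine ⟨ae_unitMeasure_iff.2 ?_, ?_⟩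
  · exact (hqsol.ae_eq_of_eqOn hpsol hpsi fun x hx => (hqpos x hx).ne').mono
      fun x hx hmem => hx (Ioo_subset_Icc_self hmem)
  · have hderiv := hqsol.deriv_eqOn hpsol hpsi (right_mem_Icc.2 zero_le_one)
    rwa [psiDeriv_one, psiDeriv_one, neg_inj] at hderiv

theorem normingConstant_eq_log_abs (b : ℝ) (n : ℕ) :
    normingConstant q b n = Real.log |varphi hq (eigenvalue q b n) 1| := by
  rw [normingConstant, phi_one_eq_varphi hq, ← Real.log_abs, abs_mul, abs_neg_one_pow, one_mul]

theorem intervalIntegrable_of_L2 (q : L2) : IntervalIntegrable q volume 0 1 :=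
  (intervalIntegrable_iff_integrableOn_Ioo_of_le zero_le_one).2
    ((Lp.memLp q).integrable one_le_two)

end Uniqueness

end MixedSturmLiouville

open MixedSturmLiouville

theorem theorem2p3_general {q p : ℝ → ℝ} (hq : IntervalIntegrable q volume 0 1)
    (hp : IntervalIntegrable p volume 0 1) {b h : ℝ}
    (heig : ∀ n, eigenvalue q b n = eigenvalue p h n)
    (hnorm : ∀ n, normingConstant q b n = normingConstant p h n) :
    q =ᵐ[unitMeasure] p ∧ b = h := by
  have hzero : ∀ r, charFun hq b r = 0 ↔ charFun hp h r = 0 := by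
    have hrange : {r | charFun hq b r = 0} = {r | charFun hp h r = 0} := by
      rw [← range_eigenvalue hq, ← range_eigenvalue hp, funext heig]
    exact Set.ext_iff.1 hrange
  refine ae_eq_and_eq_of_charFun hq hp hzero fun r hr => ?_
  obtain ⟨n, rfl⟩ : r ∈ range (eigenvalue q b) := by rwa [range_eigenvalue hq]
  have hlog := hnorm n
  rw [normingConstant_eq_log_abs hq, normingConstant_eq_log_abs hp, ← heig n] at hlog
  exact Real.log_injOn_pos (abs_pos.2 (varphi_one_ne_zero hq hr))
    (abs_pos.2 (varphi_one_ne_zero hp ((hzero _).1 hr))) hlog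

theorem theorem2p3 (q p : MixedSturmLiouville.L2) (b h : ℝ)
    (heig : ∀ n : ℕ,
      MixedSturmLiouville.eigenvalue q b n = MixedSturmLiouville.eigenvalue p h n)
    (hnorm : ∀ n : ℕ,
      MixedSturmLiouville.normingConstant q b n = MixedSturmLiouville.normingConstant p h n) :
    (q, b) = (p, h) :=
  have ⟨hqp, hbh⟩ := theorem2p3_general (intervalIntegrable_of_L2 q) (intervalIntegrable_of_L2 p)
    heig hnorm
  Prod.ext (Lp.ext hqp) hbh
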